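/- **Notation.** Let $n\ge 2$. A pair $(p,q)$ is *admissible* if $p,q\in[2,\infty]$, $\frac1p+\frac n{2q}=\frac n4$ and $(n,p,q)\ne(2,2,\infty)$. For an interval $I\subseteq[0,\infty)$ let $\|f\|_{L^p(I;L^q)}=\big\|\,\|f(t,\cdot)\|_{L^q(\mathbb R^n)}\big\|_{L^p(I)}\in[0,\infty]$. For a real valued potential $V(t,x)$ consider $$ i\partial_t u-\Delta u+V(t,x)u=0 \qquad (\ast) $$ on $I=[0,\infty)$ or $I=[0,T]$. A solution of $(\ast)$ on $I$ is a function $u\in C(I;L^2(\mathbb R^n))$ that satisfies the equation in integral form, $u(t)=e^{-it\Delta}u(0)+i\int_0^t e^{-i(t-\tau)\Delta}V(\tau)u(\tau)\,d\tau$ for all $t\in I$, where the integral converges absolutely in $L^2$. **Theorem.** Let $n\ge2$. (i) There are a real valued potential $W\in C_0^\infty(\mathbb R^n)$ and a (smooth) function $u_0$ with $u_0\in H^\sigma(\mathbb R^n)$ for all $\sigma>0$ such that $$-\Delta u_0+W u_0+u_0=0 .$$ The potential $V(t,x)\equiv W(x)$ belongs to $L^\infty([0,\infty);L^s)$ for every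 $s\in[1,\infty]$ (in particular for $s=n/2$), and the function $u(t,x)=e^{-it}u_0(x)\in C([0,\infty);L^2)$ is a solution of $(\ast)$ on $[0,\infty)$ with this $V$ and $\|u\|_{L^p([0,\infty);L^q)}=\infty$ for every admissible pair $(p,q)\neq(\infty,2)$. Consequently, for every such pair, there is no constant $C$ with $\|v\|_{L^p([0,\infty);L^q)}\le C\|v(0)\|_{L^2}$ for all solutions $v$ of $(\ast)$ on $[0,\infty)$. (ii) For every pair $(r,s)$ with $r\in[1,\infty)$, $s\in(n/2,\infty]$ and $\frac1r+\frac n{2s}\ne1$ there are a real valued potential $V\in L^r([0,\infty);L^s)$ and a sequence of solutions $u_k\in C([0,\infty);L^2)$ of $(\ast)$ on $[0,\infty)$ with $u_k(0)\ne0$ such that $$\lim_{k\to\infty}\frac{\|u_k\|_{L^p([0,\infty);L^q)}}{\|u_k(0)\|_{L^2}}=\infty\qquad\text{for every admissible pair }(p,q)\ne(\infty,2).$$ (iii) For every pair $(r,s)$ with $r\in[1,\infty)$, $s\in(n/2,\infty]$ and $\frac1r+\frac n{2s}>1$ and every $T>0$ there are a real valued potential $V\in L^r([0,T];L^s)$ and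 a sequence of solutions $u_k\in C([0,T];L^2)$ of $(\ast)$ on $[0,T]$ with $u_k(0)\ne0$ such that $$\lim_{k\to\infty}\frac{\|u_k\|_{L^p([0,T];L^q)}}{\|u_k(0)\|_{L^2}}=\infty\qquad\text{for every admissible pair }(p,q)\ne(\infty,2).$$ -/

import Mathlib

open MeasureTheory Filter Topology
open scoped ENNReal NNReal ContDiff FourierTransform SchwartzMap Laplacian

noncomputable section

namespace Schrodinger

/-- Euclidean space `ℝⁿ`. -/
abbrev Space (n : ℕ) : Type := EuclideanSpace ℝ (Fin n)

/-- The Hilbert space `L²(ℝⁿ; ℂ)`. -/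
abbrev L2 (n : ℕ) : Type := Lp ℂ 2 (volume : Measure (Space n))

/-- `(p, q)` is Schrödinger admissible in dimension `n`:
`1/p + n/(2q) = n/4`, `p, q ∈ [2, ∞]`, `(n, p, q) ≠ (2, 2, ∞)`. -/
def Admissible (n : ℕ) (p q : ℝ≥0∞) : Prop :=
  1 / p + (n : ℝ≥0∞) / (2 * q) = (n : ℝ≥0∞) / 4 ∧ 2 ≤ p ∧ 2 ≤ q ∧
    ¬ (n = 2 ∧ p = 2 ∧ q = ⊤)

/-- The mixed norm `‖f‖_{L^p(I; L^q(ℝⁿ))}`, with values in `[0, ∞]`. -/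
def mixedNorm {n : ℕ} {F : Type*} [NormedAddCommGroup F] (I : Set ℝ) (p q : ℝ≥0∞)
    (f : ℝ → Space n → F) : ℝ≥0∞ :=
  eLpNorm (fun t => eLpNorm (f t) q volume) p (volume.restrict I)

/-- `V ∈ L^r(I; L^s(ℝⁿ))` for a real valued function `V(t, x)`. -/
def MemMixed {n : ℕ} (I : Set ℝ) (r s : ℝ≥0∞) (V : ℝ → Space n → ℝ) : Prop :=
  AEStronglyMeasurable (Function.uncurry V)
    ((volume.restrict I).prod (volume : Measure (Space n))) ∧
  mixedNorm I r s V < ⊤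

/-- The symbol `exp(i t |2πξ|²)` of `e^{-itΔ}`; Mathlib's Fourier transform has the kernel
`exp(-2πi x·ξ)`, so `Δ` has the symbol `-|2πξ|²`. -/
def freeSymbol (n : ℕ) (t : ℝ) (ξ : Space n) : ℂ :=
  Complex.exp (((t * (2 * Real.pi * ‖ξ‖) ^ 2 : ℝ) : ℂ) * Complex.I)

theorem memLp_freeSymbol_mul {n : ℕ} (t : ℝ) (g : L2 n) :
    MemLp (fun ξ => freeSymbol n t ξ * g ξ) 2 (volume : Measure (Space n)) := by
  have hc : Continuous (freeSymbol n t) := by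
    unfold freeSymbol
    fun_prop
  refine (Lp.memLp g).of_le (hc.aestronglyMeasurable.mul (Lp.aestronglyMeasurable g)) ?_
  refine Eventually.of_forall fun ξ => ?_
  rw [norm_mul, freeSymbol, Complex.norm_exp_ofReal_mul_I, one_mul]

/-- The free propagator `e^{-itΔ}` on `L²(ℝⁿ)`, i.e. the solution operator of
`i ∂ₜ u - Δ u = 0`, as a Fourier multiplier. -/
def freePropagator {n : ℕ} (t : ℝ) (f : L2 n) : L2 n :=
  𝓕⁻ ((memLp_freeSymbol_mul t (𝓕 f : L2 n)).toLp _ : L2 n)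

/-- `u ∈ C(I; L²)` solves `i ∂ₜ u - Δ u + V(t, x) u = 0` on the time interval `I ∋ 0`, in the
integral form `u(t) = e^{-itΔ} u(0) + i ∫₀ᵗ e^{-i(t-τ)Δ} [V(τ) u(τ)] dτ` for all `t ∈ I`.
Here `G τ` is the element of `L²` represented by `V(τ) u(τ)`, and the integral is an absolutely
convergent (Bochner) integral in `L²`. -/
structure IsSolution {n : ℕ} (I : Set ℝ) (V : ℝ → Space n → ℝ) (u : ℝ → L2 n) : Prop where
  continuousOn : ContinuousOn u I
  duhamel : ∃ G : ℝ → L2 n,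
    (∀ᵐ τ ∂(volume.restrict I),
      (G τ : Space n → ℂ) =ᵐ[volume] fun x => (V τ x : ℂ) * u τ x) ∧
    ∀ t ∈ I,
      IntervalIntegrable (fun τ => freePropagator (t - τ) (G τ)) volume 0 t ∧
      u t = freePropagator t (u 0) +
        Complex.I • ∫ τ in (0 : ℝ)..t, freePropagator (t - τ) (G τ)

/-- The norm `‖u‖_{L^p(I; L^q)}` of an `L²` valued function. -/
def strichartzNorm {n : ℕ} (I : Set ℝ) (p q : ℝ≥0∞) (u : ℝ → L2 n) : ℝ≥0∞ :=
  mixedNorm I p q (fun t => (u t : Space n → ℂ))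

/-- The standing wave `t ↦ e^{-it} f`. -/
def standingWave {n : ℕ} (f : L2 n) (t : ℝ) : L2 n :=
  Complex.exp (-(Complex.I * t)) • f

end Schrodinger

end

/-!
If `u₀ - Δ u₀ = φ` with `φ ≥ 0` a bump function, then `u₀ > 0` by the maximum principle, so that
`W = -φ / u₀` is a compactly supported potential with the bound state `u₀`. The `L^q` norm of the
standing wave `e^{-it} u₀` does not depend on time, and its `L^p L^q` norm over an infinite
interval is infinite.

In general the copies `ε_j⁻² W((x - c_j)/ε_j)` of `W` are switched on one after the other, each
for a time `(j + 1) ε_j²`, and `u_k` is the solution which equals the rescaled standing wave while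
the `k`-th copy is on. By scaling, its Strichartz ratio is at least a constant times
`(k + 1)^{1/p}`, while the scales `ε_j` can be chosen such that the potential has a finite norm,
because `1/r + n/(2s) ≠ 1`. If `1/r + n/(2s) > 1`, the scales can moreover be so small that the
total time is at most `T`. Infinitely many copies may then be switched on before a finite time; the
solutions nevertheless exist, because the centres `c_j` go to infinity so fast that the solutions
`u_k`, `k ≤ j`, hardly feel the `j`-th copy.
-/

noncomputable section

namespace Schrodinger

open scoped BoundedContinuousFunction InnerProductSpace

/-! ### The Laplacian and the maximum principle -/

section Laplacian

variable {E F : Type*} [NormedAddCommGroup E] [InnerProductSpace ℝ E]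
  [NormedAddCommGroup F] [NormedSpace ℝ F]

theorem contDiff_exp_neg_norm_sq {k : WithTop ℕ∞} :
    ContDiff ℝ k (fun x : E => Real.exp (-‖x‖ ^ 2)) :=
  (contDiff_norm_sq ℝ).neg.exp

theorem iteratedFDeriv_two_diag_eq_deriv_deriv {f : E → F} (hf : ContDiff ℝ 2 f) (x v : E) :
    iteratedFDeriv ℝ 2 f x ![v, v] = deriv (deriv fun t : ℝ => f (x + t • v)) 0 := by
  have hline : (fun t : ℝ => f (x + t • v))
      = (fun y => f (x + y)) ∘ (ContinuousLinearMap.toSpanSingleton ℝ v) := by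
    ext t
    simp [ContinuousLinearMap.toSpanSingleton_apply]
  rw [← iteratedDeriv_one (f := fun t : ℝ => f (x + t • v)), ← iteratedDeriv_succ, hline,
    iteratedDeriv_eq_iteratedFDeriv,
    ContinuousLinearMap.iteratedFDeriv_comp_right _ (by fun_prop) _ le_rfl,
    iteratedFDeriv_comp_add_left]
  simp only [ContinuousMultilinearMap.compContinuousLinearMap_apply, map_zero, add_zero]
  congr 1
  ext j
  fin_cases j <;> simp [ContinuousLinearMap.toSpanSingleton_apply]

variable [FiniteDimensional ℝ E]

theorem laplacian_eq_sum_deriv_deriv {ι : Type*} [Fintype ι] (b : OrthonormalBasis ι ℝ E)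
    {f : E → F} (hf : ContDiff ℝ 2 f) (x : E) :
    Δ f x = ∑ i, deriv (deriv fun t : ℝ => f (x + t • b i)) 0 := by
  simp only [InnerProductSpace.laplacian_eq_iteratedFDeriv_orthonormalBasis f b,
    iteratedFDeriv_two_diag_eq_deriv_deriv hf]

theorem laplacian_comp_smul_sub {f : E → F} (hf : ContDiff ℝ 2 f) (a : ℝ) (c x : E) :
    Δ (fun y => f (a • (y - c))) x = a ^ 2 • Δ f (a • (x - c)) := by
  have hcomp : (fun y => f (a • (y - c)))
      = fun y => (f ∘ (a • ContinuousLinearMap.id ℝ E)) (y - c) := by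
    ext
    simp
  simp only [InnerProductSpace.laplacian_eq_iteratedFDeriv_stdOrthonormalBasis]
  rw [hcomp, iteratedFDeriv_comp_sub, ContinuousLinearMap.iteratedFDeriv_comp_right _ hf _ le_rfl,
    Finset.smul_sum]
  refine Finset.sum_congr rfl fun i _ => ?_
  simp only [ContinuousMultilinearMap.compContinuousLinearMap_apply]
  simpa using (iteratedFDeriv ℝ 2 f (a • (x - c))).map_smul_univ (fun _ => a)
    ![stdOrthonormalBasis ℝ E i, stdOrthonormalBasis ℝ E i]

theorem deriv_deriv_nonneg_of_isLocalMin {g : ℝ → ℝ} {x : ℝ} (h : IsLocalMin g x)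
    (hc : ContinuousAt g x) : 0 ≤ deriv (deriv g) x := by
  by_contra! hneg
  have hmax : IsLocalMax g x := isLocalMax_of_deriv_deriv_neg hneg h.deriv_eq_zero hc
  have hconst : g =ᶠ[𝓝 x] fun _ => g x := by
    filter_upwards [h, hmax] with y hge hle using le_antisymm hle hge
  simp [hconst.deriv.deriv_eq] at hneg

theorem laplacian_nonneg_of_isMin {f : E → ℝ} (hf : ContDiff ℝ 2 f) {x : E}
    (h : ∀ y, f x ≤ f y) : 0 ≤ Δ f x := by
  rw [laplacian_eq_sum_deriv_deriv (stdOrthonormalBasis ℝ E) hf]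
  refine Finset.sum_nonneg fun i _ => deriv_deriv_nonneg_of_isLocalMin ?_ ?_
  · exact Eventually.of_forall fun t => by simpa using h _
  · exact (hf.continuous.comp (by fun_prop)).continuousAt

theorem nonneg_of_sub_laplacian_nonneg {f : E → ℝ} (hf : ContDiff ℝ 2 f)
    (hlim : Tendsto f (cocompact E) (𝓝 0)) (h : ∀ x, 0 ≤ f x - Δ f x) (x : E) : 0 ≤ f x := by
  by_contra! hx
  obtain ⟨y, hy⟩ := hf.continuous.exists_forall_le' x
    ((hlim.eventually (lt_mem_nhds hx)).mono fun _ h => h.le)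
  linarith [laplacian_nonneg_of_isMin hf hy, h y, hy x]

theorem deriv_deriv_exp_neg_quadratic (a b : ℝ) :
    deriv (deriv fun t : ℝ => Real.exp (-(a + 2 * b * t + t ^ 2))) 0
      = (4 * b ^ 2 - 2) * Real.exp (-a) := by
  have hquad (t : ℝ) :
      HasDerivAt (fun t : ℝ => -(a + 2 * b * t + t ^ 2)) (-(2 * b + 2 * t)) t := by
    convert! ((((hasDerivAt_id t).const_mul (2 * b)).const_add a).add
      ((hasDerivAt_id t).pow 2)).neg using 1
    simp
  have hlin : HasDerivAt (fun t : ℝ => -(2 * b + 2 * t)) (-2) 0 := by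
    convert! (((hasDerivAt_id (0 : ℝ)).const_mul 2).const_add (2 * b)).neg using 1
    simp
  rw [show (deriv fun t : ℝ => Real.exp (-(a + 2 * b * t + t ^ 2))) =
    fun t => Real.exp (-(a + 2 * b * t + t ^ 2)) * (-(2 * b + 2 * t)) from
    funext fun t => (hquad t).exp.deriv]
  refine ((hquad 0).exp.mul hlin).deriv.trans ?_
  simp only [mul_zero, ne_eq, OfNat.ofNat_ne_zero, not_false_eq_true, zero_pow, add_zero]
  ring

theorem laplacian_exp_neg_norm_sq (x : E) :
    Δ (fun y : E => Real.exp (-‖y‖ ^ 2)) x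
      = (4 * ‖x‖ ^ 2 - 2 * Module.finrank ℝ E) * Real.exp (-‖x‖ ^ 2) := by
  let b := stdOrthonormalBasis ℝ E
  have hnorm (i : Fin _) (t : ℝ) :
      ‖x + t • b i‖ ^ 2 = ‖x‖ ^ 2 + 2 * ⟪x, b i⟫_ℝ * t + t ^ 2 := by
    rw [norm_add_sq_real, inner_smul_right, norm_smul, b.norm_eq_one, mul_one, Real.norm_eq_abs,
      sq_abs]
    ring
  rw [laplacian_eq_sum_deriv_deriv b contDiff_exp_neg_norm_sq]
  simp_rw [hnorm, deriv_deriv_exp_neg_quadratic]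
  rw [← Finset.sum_mul, Finset.sum_sub_distrib, ← Finset.mul_sum,
    show ∑ i, ⟪x, b i⟫_ℝ ^ 2 = ‖x‖ ^ 2 by simpa using b.sum_sq_norm_inner_left x]
  simp [mul_comm]

theorem tendsto_exp_neg_norm_sq_cocompact :
    Tendsto (fun x : E => Real.exp (-‖x‖ ^ 2)) (cocompact E) (𝓝 0) :=
  Real.tendsto_exp_neg_atTop_nhds_zero.comp
    ((tendsto_pow_atTop two_ne_zero).comp tendsto_norm_cocompact_atTop)

end Laplacian

/-! ### A potential with a bound state -/

section BoundState

variable {E : Type*} [NormedAddCommGroup E] [InnerProductSpace ℝ E] [FiniteDimensional ℝ E]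

/-- `g` solves `-Δg + Wg + λg = 0`, i.e. it is an eigenfunction of `-Δ + W` with energy `-λ`. -/
def IsBoundState (W : E → ℝ) (lam : ℝ) (g : E → ℂ) : Prop :=
  ∀ x, -(Δ g) x + (W x : ℂ) * g x + (lam : ℂ) * g x = 0

section Resolvent

variable [MeasurableSpace E] [BorelSpace E]

theorem fourier_laplacian_apply {F : Type*} [NormedAddCommGroup F] [NormedSpace ℂ F]
    [CompleteSpace F] (f : 𝓢(E, F)) (ξ : E) :
    𝓕 (Δ f) ξ = -((2 * Real.pi * ‖ξ‖) ^ 2 • 𝓕 f ξ) := by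
  have hsq : Function.HasTemperateGrowth (fun ξ : E => ‖ξ‖ ^ 2) := by fun_prop
  have hmul : 𝓕 (SchwartzMap.fourierMultiplierCLM F (fun ξ : E => ‖ξ‖ ^ 2) f)
      = SchwartzMap.smulLeftCLM F (fun ξ : E => ‖ξ‖ ^ 2) (𝓕 f) := by
    rw [SchwartzMap.fourierMultiplierCLM_apply, FourierTransform.fourier_fourierInv_eq]
  rw [SchwartzMap.laplacian_eq_fourierMultiplierCLM, FourierTransform.fourier_smul, hmul,
    _root_.smul_apply, SchwartzMap.smulLeftCLM_apply_apply hsq, neg_smul, smul_smul, ← mul_pow]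

theorem exists_schwartz_sub_laplacian_eq {F : Type*} [NormedAddCommGroup F] [NormedSpace ℂ F]
    [CompleteSpace F] (φ : 𝓢(E, F)) : ∃ u : 𝓢(E, F), u - Δ u = φ := by
  let σ : E → ℝ := fun ξ => (1 + ‖(2 * Real.pi) • ξ‖ ^ 2) ^ (-1 : ℝ)
  have hσ : σ.HasTemperateGrowth :=
    (Function.hasTemperateGrowth_one_add_norm_sq_rpow E (-1)).comp
      ((2 * Real.pi) • ContinuousLinearMap.id ℝ E).hasTemperateGrowth
  have hσ_mul (ξ : E) : σ ξ + (2 * Real.pi * ‖ξ‖) ^ 2 * σ ξ = 1 := by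
    have hpos : 1 + ‖(2 * Real.pi) • ξ‖ ^ 2 ≠ 0 := by positivity
    have hnorm : ‖(2 * Real.pi) • ξ‖ = 2 * Real.pi * ‖ξ‖ := by
      rw [norm_smul, Real.norm_of_nonneg (by positivity)]
    rw [← one_add_mul, ← hnorm]
    simp only [σ, Real.rpow_neg_one, mul_inv_cancel₀ hpos]
  let u : 𝓢(E, F) := 𝓕⁻ (SchwartzMap.smulLeftCLM F σ (𝓕 φ))
  have hu (ξ : E) : 𝓕 u ξ = σ ξ • 𝓕 φ ξ := by
    rw [FourierTransform.fourier_fourierInv_eq, SchwartzMap.smulLeftCLM_apply_apply hσ]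
  refine ⟨u, (FourierTransform.fourierEquiv ℂ 𝓢(E, F)).injective (SchwartzMap.ext fun ξ => ?_)⟩
  simp only [FourierTransform.fourierEquiv_apply]
  rw [sub_eq_add_neg, FourierTransform.fourier_add, FourierTransform.fourier_neg,
    _root_.add_apply, _root_.neg_apply, fourier_laplacian_apply, hu, neg_neg, smul_smul,
    ← add_smul, hσ_mul, one_smul]

theorem exists_realSchwartz_sub_laplacian_eq (φ : 𝓢(E, ℝ)) :
    ∃ v : 𝓢(E, ℝ), ∀ x, v x - Δ (v : E → ℝ) x = φ x := by
  obtain ⟨u, hu⟩ := exists_schwartz_sub_laplacian_eq (φ.postcompCLM Complex.ofRealCLM)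
  refine ⟨u.postcompCLM Complex.reCLM, fun x => ?_⟩
  have hre : Δ (fun y => (u y).re) x = (Δ u x).re := by
    rw [SchwartzMap.laplacian_apply]
    exact (u.smooth 2).contDiffAt.laplacian_CLM_comp_left (l := Complex.reCLM)
  have hux : u x - Δ u x = (φ x : ℂ) := congrArg (· x) hu
  calc (u x).re - Δ (fun y => (u y).re) x = (u x - Δ u x).re := by rw [hre, Complex.sub_re]
    _ = φ x := by rw [hux, Complex.ofReal_re]

end Resolvent

theorem sub_laplacian_exp_neg_norm_sq_le (b : ContDiffBump (0 : E))
    (hb : (1 + 2 * Module.finrank ℝ E : ℝ) ≤ 4 * b.rIn ^ 2) (x : E) :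
    Real.exp (-‖x‖ ^ 2) - Δ (fun y : E => Real.exp (-‖y‖ ^ 2)) x
      ≤ (1 + 2 * Module.finrank ℝ E) * b x := by
  rw [laplacian_exp_neg_norm_sq]
  have hexp : Real.exp (-‖x‖ ^ 2) ≤ 1 := Real.exp_le_one_iff.2 (by simp)
  have hexp_pos := Real.exp_pos (-‖x‖ ^ 2)
  rcases le_total ‖x‖ b.rIn with hx | hx
  · rw [b.one_of_mem_closedBall (by simpa using hx)]
    nlinarith [mul_nonneg (sq_nonneg ‖x‖) hexp_pos.le]
  · have hneg : 1 + 2 * (Module.finrank ℝ E : ℝ) - 4 * ‖x‖ ^ 2 ≤ 0 := by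
      nlinarith [b.rIn_pos]
    nlinarith [mul_nonneg (by positivity : (0 : ℝ) ≤ 1 + 2 * Module.finrank ℝ E)
      (b.nonneg (x := x))]

theorem exists_boundState (E : Type*) [NormedAddCommGroup E] [InnerProductSpace ℝ E]
    [FiniteDimensional ℝ E] [MeasurableSpace E] [BorelSpace E] :
    ∃ (W : E → ℝ) (g : 𝓢(E, ℂ)), ContDiff ℝ ∞ W ∧ HasCompactSupport W ∧ (∀ x, g x ≠ 0) ∧
      IsBoundState W 1 g := by
  let d : ℝ := Module.finrank ℝ E
  have hd : 0 ≤ d := Nat.cast_nonneg _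
  let b : ContDiffBump (0 : E) := ⟨d + 1, d + 2, by linarith, by linarith⟩
  let φ : E → ℝ := fun x => (1 + 2 * d) * b x
  have hφ : ContDiff ℝ ∞ φ := contDiff_const.mul b.contDiff
  have hφs : HasCompactSupport φ := b.hasCompactSupport.mul_left
  obtain ⟨v, hv⟩ := exists_realSchwartz_sub_laplacian_eq (hφs.toSchwartzMap hφ)
  have hvs : ContDiff ℝ 2 v := v.smooth 2
  -- The Gaussian is a subsolution, so it bounds `v` from below.
  have hgauss (x : E) : Real.exp (-‖x‖ ^ 2) ≤ v x := by
    refine sub_nonneg.1 (nonneg_of_sub_laplacian_nonneg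
      (f := (v : E → ℝ) - fun y => Real.exp (-‖y‖ ^ 2)) (hvs.sub contDiff_exp_neg_norm_sq)
      ?_ (fun y => ?_) x)
    · simpa [Pi.sub_def] using
        v.toZeroAtInfty.zero_at_infty'.sub tendsto_exp_neg_norm_sq_cocompact
    · have hbarrier : Real.exp (-‖y‖ ^ 2) - Δ (fun y : E => Real.exp (-‖y‖ ^ 2)) y ≤ φ y :=
        sub_laplacian_exp_neg_norm_sq_le b (by simp only [b]; nlinarith) y
      have hvy : v y - Δ (v : E → ℝ) y = φ y := hv y
      rw [hvs.contDiffAt.laplacian_sub contDiff_exp_neg_norm_sq.contDiffAt, Pi.sub_apply]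
      linarith
  have hpos (x : E) : 0 < v x := (Real.exp_pos _).trans_le (hgauss x)
  have hlap (x : E) : Δ (fun y => (v y : ℂ)) x = (Δ (v : E → ℝ) x : ℂ) :=
    hvs.contDiffAt.laplacian_CLM_comp_left (l := Complex.ofRealCLM)
  refine ⟨fun x => -φ x / v x, v.postcompCLM Complex.ofRealCLM, ?_, ?_, fun x => ?_, fun x => ?_⟩
  · exact hφ.neg.div (v.smooth ⊤) fun x => (hpos x).ne'
  · simp_rw [div_eq_mul_inv]
    exact hφs.neg.mul_right
  · exact Complex.ofReal_ne_zero.2 (hpos x).ne'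
  · have hreal : -Δ (v : E → ℝ) x + -φ x / v x * v x + 1 * v x = 0 := by
      have hvx : v x - Δ (v : E → ℝ) x = φ x := hv x
      rw [div_mul_cancel₀ _ (hpos x).ne']
      linarith
    change -(Δ fun y => (v y : ℂ)) x + _ * (v x : ℂ) + _ * (v x : ℂ) = 0
    rw [hlap]
    exact_mod_cast hreal

end BoundState

/-! ### Dominated convergence and multiplication operators in `Lᵖ` -/

section DominatedConvergence

variable {α F : Type*} [MeasurableSpace α] {μ : Measure α} [NormedAddCommGroup F] {p : ℝ≥0∞}
  [Fact (1 ≤ p)]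

theorem tendsto_Lp_of_dominated (hp : p ≠ ⊤) {ι : Type*} {l : Filter ι} [l.IsCountablyGenerated]
    {f : ι → Lp F p μ} {f₀ : Lp F p μ} {φ : ι → α → F} {bound : α → ℝ}
    (hf : ∀ i, f i =ᵐ[μ] φ i) (hbound : MemLp bound p μ)
    (hle : ∀ᶠ i in l, ∀ᵐ x ∂μ, ‖φ i x‖ ≤ bound x)
    (hlim : ∀ᵐ x ∂μ, Tendsto (φ · x) l (𝓝 (f₀ x))) : Tendsto f l (𝓝 f₀) := by
  have hp0 : p ≠ 0 := (zero_lt_one.trans_le (Fact.out : 1 ≤ p)).ne'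
  have hp_pos : 0 < p.toReal := ENNReal.toReal_pos hp0 hp
  have hnorm (i : ι) : eLpNorm (⇑(f i) - ⇑f₀) p μ
      = (∫⁻ x, ‖φ i x - f₀ x‖ₑ ^ p.toReal ∂μ) ^ (1 / p.toReal) := by
    rw [eLpNorm_congr_ae ((hf i).sub (ae_eq_refl f₀)),
      eLpNorm_eq_lintegral_rpow_enorm_toReal hp0 hp]
    rfl
  rw [Lp.tendsto_Lp_iff_tendsto_eLpNorm']
  simp_rw [hnorm]
  suffices hint : Tendsto (fun i => ∫⁻ x, ‖φ i x - f₀ x‖ₑ ^ p.toReal ∂μ) l (𝓝 (∫⁻ _, 0 ∂μ)) by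
    simpa [hp_pos] using hint.ennrpow_const (1 / p.toReal)
  refine tendsto_lintegral_filter_of_dominated_convergence'
    (fun x => ‖bound x + ‖f₀ x‖‖ₑ ^ p.toReal) ?_ ?_ ?_ ?_
  · refine Eventually.of_forall fun i => AEMeasurable.pow_const (AEStronglyMeasurable.enorm ?_) _
    exact ((Lp.aestronglyMeasurable (f i)).congr (hf i)).sub (Lp.aestronglyMeasurable f₀)
  · filter_upwards [hle] with i hi
    filter_upwards [hi] with x hx
    gcongr
    refine enorm_le_iff_norm_le.2 (((norm_sub_le _ _).trans ?_).trans (le_abs_self _))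
    gcongr
  · exact ((eLpNorm_lt_top_iff_lintegral_rpow_enorm_lt_top hp0 hp).1
      (hbound.add (Lp.memLp f₀).norm).2).ne
  · filter_upwards [hlim] with x hx
    have hsub : Tendsto (fun i => ‖φ i x - f₀ x‖ₑ) l (𝓝 0) := by
      simpa using (hx.sub_const (f₀ x)).enorm
    simpa [hp_pos] using hsub.ennrpow_const p.toReal

theorem hasDerivAt_Lp_of_dominated [NormedSpace ℝ F] (hp : p ≠ ⊤) {u : ℝ → Lp F p μ}
    {u' : Lp F p μ} {t : ℝ} {φ : ℝ → α → F} {bound : α → ℝ} (hu : ∀ s, u s =ᵐ[μ] φ s)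
    (hbound : MemLp bound p μ) (hle : ∀ᵐ x ∂μ, ∀ s, ‖φ s x - φ t x‖ ≤ bound x * |s - t|)
    (hderiv : ∀ᵐ x ∂μ, HasDerivAt (φ · x) (u' x) t) : HasDerivAt u u' t := by
  rw [hasDerivAt_iff_tendsto_slope]
  refine tendsto_Lp_of_dominated hp (φ := fun s x => slope (φ · x) t s) (fun s => ?_) hbound ?_
    (hderiv.mono fun x hx => hasDerivAt_iff_tendsto_slope.1 hx)
  · filter_upwards [hu s, hu t, Lp.coeFn_smul (s - t)⁻¹ (u s - u t), Lp.coeFn_sub (u s) (u t)]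
      with x hs ht hsmul hsub
    simp only [slope_def_module, hsmul, Pi.smul_apply, hsub, Pi.sub_apply, hs, ht]
  · filter_upwards [self_mem_nhdsWithin] with s hs
    filter_upwards [hle] with x hx
    rw [slope_def_module, norm_smul, norm_inv, Real.norm_eq_abs,
      inv_mul_le_iff₀ (abs_pos.2 (sub_ne_zero.2 hs)), mul_comm]
    exact hx s

end DominatedConvergence

section MulLp

variable {α 𝕜 : Type*} [TopologicalSpace α] [MeasurableSpace α] [OpensMeasurableSpace α]
  [RCLike 𝕜] {μ : Measure α} {p : ℝ≥0∞}

theorem memLp_top_boundedContinuousFunction (w : α →ᵇ 𝕜) : MemLp w ⊤ μ :=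
  memLp_top_of_bound w.continuous.aestronglyMeasurable ‖w‖
    (Eventually.of_forall w.norm_coe_le_norm)

variable [Fact (1 ≤ p)]

/-- Multiplication by a bounded continuous function, as an operator on `Lᵖ`. -/
def mulLp (w : α →ᵇ 𝕜) : Lp 𝕜 p μ →L[𝕜] Lp 𝕜 p μ :=
  (ContinuousLinearMap.mul 𝕜 𝕜).holderL μ ⊤ p p ((memLp_top_boundedContinuousFunction w).toLp w)

theorem coeFn_mulLp (w : α →ᵇ 𝕜) (g : Lp 𝕜 p μ) : mulLp w g =ᵐ[μ] fun x => w x * g x := by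
  filter_upwards [(ContinuousLinearMap.mul 𝕜 𝕜).coeFn_holder (r := p)
    ((memLp_top_boundedContinuousFunction (μ := μ) w).toLp w) g,
    (memLp_top_boundedContinuousFunction (μ := μ) w).coeFn_toLp] with x hmul hw
  refine hmul.trans ?_
  rw [hw, ContinuousLinearMap.mul_apply']

theorem norm_mulLp_le (w : α →ᵇ 𝕜) : ‖mulLp (μ := μ) (p := p) w‖ ≤ ‖w‖ := by
  refine ContinuousLinearMap.opNorm_le_bound _ (norm_nonneg _) fun g => ?_
  refine Lp.norm_le_mul_norm_of_ae_le_mul ?_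
  filter_upwards [coeFn_mulLp w g] with x hx
  rw [hx, norm_mul]
  gcongr
  exact w.norm_coe_le_norm x

theorem mulLp_mul (v w : α →ᵇ 𝕜) (g : Lp 𝕜 p μ) : mulLp (v * w) g = mulLp v (mulLp w g) := by
  refine Lp.ext ?_
  filter_upwards [coeFn_mulLp (v * w) g, coeFn_mulLp v (mulLp w g), coeFn_mulLp w g]
    with x hvw hv hw
  rw [hvw, hv, hw, BoundedContinuousFunction.mul_apply, mul_assoc]

theorem mulLp_one (g : Lp 𝕜 p μ) : mulLp (1 : α →ᵇ 𝕜) g = g := by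
  refine Lp.ext ?_
  filter_upwards [coeFn_mulLp 1 g] with x hx
  simp [hx]

theorem norm_mulLp_apply_of_norm_eq_one {w : α →ᵇ 𝕜} (hw : ∀ x, ‖w x‖ = 1) (g : Lp 𝕜 p μ) :
    ‖mulLp w g‖ = ‖g‖ := by
  rw [Lp.norm_def, Lp.norm_def]
  congr 1
  refine eLpNorm_congr_norm_ae ?_
  filter_upwards [coeFn_mulLp w g] with x hx
  rw [hx, norm_mul, hw, one_mul]

theorem tendsto_mulLp (hp : p ≠ ⊤) {ι : Type*} {l : Filter ι} [l.IsCountablyGenerated]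
    {w : ι → α →ᵇ 𝕜} {w₀ : α →ᵇ 𝕜} {C : ℝ} (hC : ∀ᶠ i in l, ‖w i‖ ≤ C)
    (hlim : ∀ x, Tendsto (w · x) l (𝓝 (w₀ x))) (g : Lp 𝕜 p μ) :
    Tendsto (fun i => mulLp (w i) g) l (𝓝 (mulLp w₀ g)) := by
  refine tendsto_Lp_of_dominated hp (fun i => coeFn_mulLp (w i) g)
    ((Lp.memLp g).norm.const_mul C) (hC.mono fun i hi => Eventually.of_forall fun x => ?_) ?_
  · rw [norm_mul]
    gcongr
    exact ((w i).norm_coe_le_norm x).trans hi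
  · filter_upwards [coeFn_mulLp w₀ g] with x hx
    rw [hx]
    exact (hlim x).mul_const _

theorem inner_mulLp_left {w : α →ᵇ 𝕜} (hw : ∀ x, starRingEnd 𝕜 (w x) = w x) (f g : Lp 𝕜 2 μ) :
    ⟪mulLp w f, g⟫_𝕜 = ⟪f, mulLp w g⟫_𝕜 := by
  rw [L2.inner_def, L2.inner_def]
  refine integral_congr_ae ?_
  filter_upwards [coeFn_mulLp w f, coeFn_mulLp w g] with x hf hg
  rw [hf, hg, RCLike.inner_apply, RCLike.inner_apply, map_mul, hw]
  ring

end MulLp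

/-! ### Bounded families of operators -/

section BoundedFamily

variable {𝕜 E F ι : Type*} [NontriviallyNormedField 𝕜] [NormedAddCommGroup E] [NormedSpace 𝕜 E]
  [NormedAddCommGroup F] [NormedSpace 𝕜 F] {l : Filter ι} {T : ι → E →L[𝕜] F} {M : ℝ}

theorem tendsto_apply_of_norm_le (hT : ∀ i, ‖T i‖ ≤ M) {x : ι → E} {x₀ : E} {y : F}
    (hx : Tendsto x l (𝓝 x₀)) (hlim : Tendsto (fun i => T i x₀) l (𝓝 y)) :
    Tendsto (fun i => T i (x i)) l (𝓝 y) := by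
  have hdiff : Tendsto (fun i => T i (x i - x₀)) l (𝓝 0) := by
    refine squeeze_zero_norm (fun i => (T i).le_of_opNorm_le (hT i) _) ?_
    simpa using (hx.sub_const x₀).norm.const_mul M
  simpa using hdiff.add hlim

theorem continuous_apply_of_norm_le {X : Type*} [TopologicalSpace X] {T : X → E →L[𝕜] F}
    (hT : ∀ x, ‖T x‖ ≤ M) (hc : ∀ y, Continuous fun x => T x y) {f : X → E} (hf : Continuous f) :
    Continuous fun x => T x (f x) :=
  continuous_iff_continuousAt.2 fun x =>
    tendsto_apply_of_norm_le hT (hf.tendsto x) ((hc (f x)).tendsto x)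

theorem eventually_forall_norm_le_of_isCompact (hT : ∀ i, ‖T i‖ ≤ M)
    (hlim : ∀ x, Tendsto (fun i => T i x) l (𝓝 0)) {K : Set E} (hK : IsCompact K) {δ : ℝ}
    (hδ : 0 < δ) : ∀ᶠ i in l, ∀ x ∈ K, ‖T i x‖ ≤ δ := by
  have hlocal (x : E) : ∀ᶠ q : ι × E in l ×ˢ 𝓝 x, ‖T q.1 q.2‖ ≤ δ := by
    have htend : Tendsto (fun q : ι × E => T q.1 q.2) (l ×ˢ 𝓝 x) (𝓝 0) :=
      tendsto_apply_of_norm_le (T := fun q : ι × E => T q.1) (fun q => hT q.1) tendsto_snd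
        ((hlim x).comp tendsto_fst)
    filter_upwards [htend.norm.eventually_le_const (by simpa using hδ)] with q hq using hq
  have hnhds : ∀ᶠ q : ι × E in l ×ˢ 𝓝ˢ K, ‖T q.1 q.2‖ ≤ δ := by
    simpa only [hK.prod_nhdsSet_eq_biSup, eventually_iSup] using fun x _ => hlocal x
  exact hnhds.curry.mono fun i hi => hi.self_of_nhdsSet

end BoundedFamily

section PotentialOp

variable {α : Type*} [TopologicalSpace α]

theorem norm_compLeftContinuousBounded_ofReal_le (w : α →ᵇ ℝ) :
    ‖Complex.ofRealCLM.compLeftContinuousBounded α w‖ ≤ ‖w‖ :=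
  (BoundedContinuousFunction.norm_le (norm_nonneg w)).2 fun x =>
    (Complex.norm_real (w x)).trans_le (w.norm_coe_le_norm x)

variable [MeasurableSpace α] [OpensMeasurableSpace α] {μ : Measure α} {p : ℝ≥0∞} [Fact (1 ≤ p)]

/-- Multiplication of complex functions by a bounded real potential, as an operator on `Lᵖ`. -/
def potentialOp (w : α →ᵇ ℝ) : Lp ℂ p μ →L[ℂ] Lp ℂ p μ :=
  mulLp (Complex.ofRealCLM.compLeftContinuousBounded α w)

theorem coeFn_potentialOp (w : α →ᵇ ℝ) (f : Lp ℂ p μ) :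
    potentialOp w f =ᵐ[μ] fun x => (w x : ℂ) * f x :=
  coeFn_mulLp _ f

theorem norm_potentialOp_le (w : α →ᵇ ℝ) : ‖potentialOp (μ := μ) (p := p) w‖ ≤ ‖w‖ :=
  (norm_mulLp_le _).trans (norm_compLeftContinuousBounded_ofReal_le w)

theorem tendsto_potentialOp_zero (hp : p ≠ ⊤) {ι : Type*} {l : Filter ι} [l.IsCountablyGenerated]
    {w : ι → α →ᵇ ℝ} {C : ℝ} (hC : ∀ i, ‖w i‖ ≤ C) (hlim : ∀ x, Tendsto (w · x) l (𝓝 0))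
    (f : Lp ℂ p μ) : Tendsto (fun i => potentialOp (w i) f) l (𝓝 0) := by
  have hlim' := tendsto_mulLp (μ := μ) hp (w₀ := Complex.ofRealCLM.compLeftContinuousBounded α 0)
    (Eventually.of_forall fun i => (norm_compLeftContinuousBounded_ofReal_le (w i)).trans (hC i))
    (fun x => (Complex.continuous_ofReal.tendsto _).comp (hlim x)) f
  have hzero : mulLp (Complex.ofRealCLM.compLeftContinuousBounded α 0) f = 0 := by
    refine (Lp.eq_zero_iff_ae_eq_zero).2 ((coeFn_potentialOp 0 f).trans ?_)
    exact Eventually.of_forall fun x => by simp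
  rwa [hzero] at hlim'

theorem inner_potentialOp_left (w : α →ᵇ ℝ) (f g : Lp ℂ 2 μ) :
    ⟪potentialOp w f, g⟫_ℂ = ⟪f, potentialOp w g⟫_ℂ :=
  inner_mulLp_left (fun x => Complex.conj_ofReal (w x)) f g

end PotentialOp

/-! ### The free propagator -/

section FreePropagator

variable {n : ℕ}

theorem norm_freeSymbol (t : ℝ) (ξ : Space n) : ‖freeSymbol n t ξ‖ = 1 := by
  rw [freeSymbol, Complex.norm_exp_ofReal_mul_I]

theorem freeSymbol_add (s t : ℝ) (ξ : Space n) :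
    freeSymbol n (s + t) ξ = freeSymbol n s ξ * freeSymbol n t ξ := by
  rw [freeSymbol, freeSymbol, freeSymbol, ← Complex.exp_add]
  push_cast
  ring_nf

/-- The symbol of the free propagator as a bounded continuous function. -/
def boundedFreeSymbol (n : ℕ) (t : ℝ) : Space n →ᵇ ℂ :=
  BoundedContinuousFunction.ofNormedAddCommGroup (freeSymbol n t)
    (by unfold freeSymbol; fun_prop) 1 fun ξ => (norm_freeSymbol t ξ).le

theorem boundedFreeSymbol_apply (t : ℝ) (ξ : Space n) :
    boundedFreeSymbol n t ξ = freeSymbol n t ξ := rfl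

theorem norm_boundedFreeSymbol_le (n : ℕ) (t : ℝ) : ‖boundedFreeSymbol n t‖ ≤ 1 :=
  BoundedContinuousFunction.norm_ofNormedAddCommGroup_le _ zero_le_one _

/-- The free propagator as a linear isometry. -/
def free (t : ℝ) : L2 n →ₗᵢ[ℂ] L2 n where
  toLinearMap := (Lp.fourierTransformₗᵢ (Space n) ℂ).symm.toLinearEquiv.toLinearMap ∘ₗ
    (mulLp (boundedFreeSymbol n t)).toLinearMap ∘ₗ
      (Lp.fourierTransformₗᵢ (Space n) ℂ).toLinearEquiv.toLinearMap
  norm_map' f := by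
    refine ((Lp.fourierTransformₗᵢ (Space n) ℂ).symm.norm_map _).trans ?_
    exact (norm_mulLp_apply_of_norm_eq_one (norm_freeSymbol t) _).trans
      ((Lp.fourierTransformₗᵢ (Space n) ℂ).norm_map f)

theorem free_apply (t : ℝ) (f : L2 n) :
    free t f = 𝓕⁻ (mulLp (boundedFreeSymbol n t) (𝓕 f : L2 n) : L2 n) := rfl

theorem freePropagator_eq_free (t : ℝ) (f : L2 n) : freePropagator t f = free t f := by
  rw [freePropagator, free_apply]
  congr 1
  exact Lp.ext ((MemLp.coeFn_toLp _).trans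
    (coeFn_mulLp (boundedFreeSymbol n t) (𝓕 f : L2 n)).symm)

theorem fourier_free (t : ℝ) (f : L2 n) :
    (𝓕 (free t f) : L2 n) = mulLp (boundedFreeSymbol n t) (𝓕 f : L2 n) := by
  rw [free_apply, FourierTransform.fourier_fourierInv_eq]

theorem free_add (s t : ℝ) (f : L2 n) : free (s + t) f = free s (free t f) := by
  have hsymbol : boundedFreeSymbol n (s + t) = boundedFreeSymbol n s * boundedFreeSymbol n t :=
    BoundedContinuousFunction.ext (freeSymbol_add s t)
  rw [free_apply, free_apply, fourier_free, hsymbol, mulLp_mul]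

theorem free_zero (f : L2 n) : free 0 f = f := by
  have hsymbol : boundedFreeSymbol n 0 = 1 :=
    BoundedContinuousFunction.ext fun ξ => by simp [boundedFreeSymbol_apply, freeSymbol]
  rw [free_apply, hsymbol, mulLp_one, FourierTransform.fourierInv_fourier_eq]

theorem free_neg_free (t : ℝ) (f : L2 n) : free (-t) (free t f) = f := by
  rw [← free_add, neg_add_cancel, free_zero]

theorem free_free_neg (t : ℝ) (f : L2 n) : free t (free (-t) f) = f := by
  rw [← free_add, add_neg_cancel, free_zero]

theorem continuous_free (f : L2 n) : Continuous fun t : ℝ => free t f := by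
  have hsymbol (ξ : Space n) : Continuous fun t : ℝ => boundedFreeSymbol n t ξ := by
    simp only [boundedFreeSymbol_apply, freeSymbol]
    fun_prop
  have hfourier : Continuous fun t : ℝ => mulLp (boundedFreeSymbol n t) (𝓕 f : L2 n) :=
    continuous_iff_continuousAt.2 fun t => tendsto_mulLp (by simp)
      (Eventually.of_forall (norm_boundedFreeSymbol_le n)) (fun ξ => (hsymbol ξ).tendsto t) _
  exact (Lp.fourierTransformₗᵢ (Space n) ℂ).symm.continuous.comp hfourier

theorem continuous_free_apply {X : Type*} [TopologicalSpace X] {φ : X → ℝ} {f : X → L2 n}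
    (hφ : Continuous φ) (hf : Continuous f) : Continuous fun x => free (φ x) (f x) :=
  continuous_apply_of_norm_le (T := fun x => (free (φ x)).toContinuousLinearMap)
    (fun x => (free (φ x)).norm_toContinuousLinearMap_le) (fun g => (continuous_free g).comp hφ) hf

/-- The generator `i e^{itΔ} w e^{-itΔ}` of the equation in the interaction picture: `u` solves
`i ∂ₜ u - Δ u + w u = 0` if and only if `a t = free (-t) (u t)` solves
`∂ₜ a = interaction w t a`. -/
def interaction (w : Space n →ᵇ ℝ) (t : ℝ) : L2 n →L[ℂ] L2 n :=
  Complex.I • ((free (-t)).toContinuousLinearMap ∘L potentialOp w ∘L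
    (free t).toContinuousLinearMap)

theorem interaction_apply (w : Space n →ᵇ ℝ) (t : ℝ) (f : L2 n) :
    interaction w t f = Complex.I • free (-t) (potentialOp w (free t f)) := rfl

theorem norm_interaction_apply (w : Space n →ᵇ ℝ) (t : ℝ) (f : L2 n) :
    ‖interaction w t f‖ = ‖potentialOp w (free t f)‖ := by
  rw [interaction_apply, norm_smul, Complex.norm_I, one_mul, (free (-t)).norm_map]

theorem norm_interaction_le (w : Space n →ᵇ ℝ) (t : ℝ) : ‖interaction w t‖ ≤ ‖w‖ := by
  refine ContinuousLinearMap.opNorm_le_bound _ (norm_nonneg _) fun f => ?_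
  rw [norm_interaction_apply, ← (free t).norm_map f]
  exact (potentialOp w).le_of_opNorm_le (norm_potentialOp_le w) _

theorem continuous_interaction (w : Space n →ᵇ ℝ) (f : L2 n) :
    Continuous fun t => interaction w t f :=
  (continuous_free_apply continuous_neg
    ((potentialOp w).continuous.comp (continuous_free f))).const_smul Complex.I

theorem re_inner_interaction (w : Space n →ᵇ ℝ) (t : ℝ) (f : L2 n) :
    (⟪f, interaction w t f⟫_ℂ).re = 0 := by
  have hmove : ⟪f, interaction w t f⟫_ℂ
      = Complex.I * ⟪free t f, potentialOp w (free t f)⟫_ℂ := by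
    rw [interaction_apply, inner_smul_right]
    conv_lhs => rw [← free_neg_free t f]
    rw [(free (-t)).inner_map_map, free_free_neg]
  have hreal : (⟪free t f, potentialOp w (free t f)⟫_ℂ).im = 0 := by
    rw [← Complex.conj_eq_iff_im, inner_conj_symm, inner_potentialOp_left]
  rw [hmove, Complex.I_mul_re, hreal, neg_zero]

end FreePropagator

/-! ### Bound states in the interaction picture -/

section BoundStateWave

variable {n : ℕ} {lam : ℝ}

theorem norm_exp_neg_I_mul (r : ℝ) : ‖Complex.exp (-(Complex.I * r))‖ = 1 := by
  rw [← mul_neg, ← Complex.ofReal_neg, Complex.norm_exp_I_mul_ofReal]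

/-- The standing wave `e^{-iλt} f` in the interaction picture. -/
def boundStateWave (lam : ℝ) (f : L2 n) (t : ℝ) : L2 n :=
  Complex.exp (-(Complex.I * (lam * t : ℝ))) • free (-t) f

theorem free_boundStateWave (lam : ℝ) (f : L2 n) (t : ℝ) :
    free t (boundStateWave lam f t) = Complex.exp (-(Complex.I * (lam * t : ℝ))) • f := by
  rw [boundStateWave, map_smul, free_free_neg]

theorem norm_boundStateWave (lam : ℝ) (f : L2 n) (t : ℝ) : ‖boundStateWave lam f t‖ = ‖f‖ := by
  rw [boundStateWave, norm_smul, (free (-t)).norm_map, norm_exp_neg_I_mul, one_mul]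

theorem interaction_boundStateWave (w : Space n →ᵇ ℝ) (f : L2 n) (t : ℝ) :
    interaction w t (boundStateWave lam f t)
      = Complex.I • boundStateWave lam (potentialOp w f) t := by
  rw [interaction_apply, free_boundStateWave, map_smul, map_smul, boundStateWave]

theorem coeFn_fourier_boundStateWave (lam : ℝ) (f : L2 n) (t : ℝ) :
    (𝓕 (boundStateWave lam f t) : L2 n) =ᵐ[volume] fun ξ =>
      Complex.exp (-(Complex.I * (t * ((2 * Real.pi * ‖ξ‖) ^ 2 + lam) : ℝ))) * (𝓕 f : L2 n) ξ := by
  have hfourier : (𝓕 (boundStateWave lam f t) : L2 n)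
      = Complex.exp (-(Complex.I * (lam * t : ℝ))) •
        mulLp (boundedFreeSymbol n (-t)) (𝓕 f : L2 n) := by
    rw [boundStateWave, FourierTransform.fourier_smul, fourier_free]
  rw [hfourier]
  filter_upwards [coeFn_mulLp (boundedFreeSymbol n (-t)) (𝓕 f : L2 n),
    Lp.coeFn_smul (Complex.exp (-(Complex.I * (lam * t : ℝ))))
      (mulLp (boundedFreeSymbol n (-t)) (𝓕 f : L2 n))] with ξ hmul hsmul
  rw [hsmul, Pi.smul_apply, hmul, smul_eq_mul, ← mul_assoc]
  congr 1
  rw [boundedFreeSymbol_apply, freeSymbol, ← Complex.exp_add]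
  push_cast
  ring_nf

theorem norm_exp_neg_I_mul_sub_le (a b : ℝ) :
    ‖Complex.exp (-(Complex.I * a)) - Complex.exp (-(Complex.I * b))‖ ≤ |a - b| := by
  have hfactor : Complex.exp (-(Complex.I * a)) - Complex.exp (-(Complex.I * b))
      = Complex.exp (-(Complex.I * b)) * (Complex.exp (Complex.I * (b - a : ℝ)) - 1) := by
    rw [mul_sub, mul_one, ← Complex.exp_add]
    push_cast
    ring_nf
  rw [hfactor, norm_mul, norm_exp_neg_I_mul, one_mul, abs_sub_comm]
  exact Real.norm_exp_I_mul_ofReal_sub_one_le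

theorem hasDerivAt_boundStateWave {f k : L2 n}
    (hk : (𝓕 k : L2 n) =ᵐ[volume]
      fun ξ => -((2 * Real.pi * ‖ξ‖) ^ 2 + lam : ℝ) * (𝓕 f : L2 n) ξ) (t : ℝ) :
    HasDerivAt (boundStateWave lam f) (Complex.I • boundStateWave lam k t) t := by
  have hfourier : HasDerivAt (fun s => (𝓕 (boundStateWave lam f s) : L2 n))
      (𝓕 (Complex.I • boundStateWave lam k t) : L2 n) t := by
    refine hasDerivAt_Lp_of_dominated (by simp)
      (fun s => coeFn_fourier_boundStateWave lam f s) (Lp.memLp (𝓕 k : L2 n)).norm ?_ ?_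
    · filter_upwards [hk] with ξ hξ s
      rw [← sub_mul, norm_mul, hξ, norm_mul, norm_neg, Complex.norm_real, Real.norm_eq_abs,
        mul_right_comm |_|, ← abs_mul]
      gcongr
      refine (norm_exp_neg_I_mul_sub_le _ _).trans_eq ?_
      rw [← sub_mul, mul_comm]
    · rw [FourierTransform.fourier_smul]
      filter_upwards [hk, coeFn_fourier_boundStateWave lam k t,
        Lp.coeFn_smul Complex.I (𝓕 (boundStateWave lam k t) : L2 n)] with ξ hξ hwave hsmul
      rw [hsmul, Pi.smul_apply, hwave, hξ, smul_eq_mul]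
      have hphase : HasDerivAt (fun s : ℝ => -(Complex.I *
          (s * ((2 * Real.pi * ‖ξ‖) ^ 2 + lam) : ℝ)))
          (-(Complex.I * (1 * ((2 * Real.pi * ‖ξ‖) ^ 2 + lam) : ℝ))) t :=
        ((((hasDerivAt_id t).mul_const _).ofReal_comp).const_mul Complex.I).neg
      convert! (hphase.cexp).mul_const ((𝓕 f : L2 n) ξ) using 1
      push_cast
      ring
  convert! ((Lp.fourierTransformₗᵢ (Space n) ℂ).symm.toContinuousLinearEquiv.restrictScalars
    ℝ).hasFDerivAt.comp_hasDerivAt t hfourier using 1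
  · exact funext fun s => ((Lp.fourierTransformₗᵢ (Space n) ℂ).symm_apply_apply _).symm
  · exact ((Lp.fourierTransformₗᵢ (Space n) ℂ).symm_apply_apply _).symm

theorem IsBoundState.potentialOp_toLp {w : Space n →ᵇ ℝ} {g : 𝓢(Space n, ℂ)}
    (hg : IsBoundState w lam g) : potentialOp w (g.toLp 2) = (Δ g - (lam : ℂ) • g).toLp 2 := by
  refine Lp.ext ?_
  filter_upwards [coeFn_potentialOp w (g.toLp 2), g.coeFn_toLp 2 volume,
    (Δ g - (lam : ℂ) • g).coeFn_toLp 2 volume] with x hmul hg₁ hg₂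
  rw [hmul, hg₁, hg₂, _root_.sub_apply, _root_.smul_apply, SchwartzMap.laplacian_apply, smul_eq_mul]
  linear_combination hg x

theorem IsBoundState.fourier_potentialOp_toLp {w : Space n →ᵇ ℝ} {g : 𝓢(Space n, ℂ)}
    (hg : IsBoundState w lam g) :
    (𝓕 (potentialOp w (g.toLp 2)) : L2 n) =ᵐ[volume]
      fun ξ => -((2 * Real.pi * ‖ξ‖) ^ 2 + lam : ℝ) * (𝓕 (g.toLp 2) : L2 n) ξ := by
  rw [hg.potentialOp_toLp, SchwartzMap.toLp_fourier_eq, SchwartzMap.toLp_fourier_eq]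
  have hfourier : 𝓕 (Δ g - (lam : ℂ) • g) = 𝓕 (Δ g) - (lam : ℂ) • 𝓕 g := by
    rw [← FourierTransform.fourier_smul]
    exact map_sub (FourierTransform.fourierCLM ℂ 𝓢(Space n, ℂ)) _ _
  filter_upwards [(𝓕 g).coeFn_toLp 2 volume,
    (𝓕 (Δ g - (lam : ℂ) • g)).coeFn_toLp 2 volume] with ξ hg₁ hg₂
  rw [hg₁, hg₂, hfourier, _root_.sub_apply, _root_.smul_apply, fourier_laplacian_apply,
    smul_eq_mul, Complex.real_smul]
  push_cast
  ring

theorem IsBoundState.hasDerivAt_boundStateWave {w : Space n →ᵇ ℝ} {g : 𝓢(Space n, ℂ)}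
    (hg : IsBoundState w lam g) (t : ℝ) :
    HasDerivAt (boundStateWave lam (g.toLp 2))
      (interaction w t (boundStateWave lam (g.toLp 2) t)) t := by
  rw [interaction_boundStateWave]
  exact Schrodinger.hasDerivAt_boundStateWave hg.fourier_potentialOp_toLp t

end BoundStateWave

section IsSolution

variable {n : ℕ} {I : Set ℝ} {V : ℝ → Space n → ℝ}

theorem IsSolution.mono {J : Set ℝ} {u : ℝ → L2 n} (h : IsSolution I V u) (hJ : J ⊆ I) :
    IsSolution J V u := by
  obtain ⟨G, hG, hduhamel⟩ := h.duhamel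
  exact ⟨h.continuousOn.mono hJ, G, ae_restrict_of_ae_restrict_of_subset hJ hG,
    fun t ht => hduhamel t (hJ ht)⟩

theorem isSolution_of_interaction {w : ℝ → Space n →ᵇ ℝ} {a : ℝ → L2 n} (ha : Continuous a)
    (hint : ∀ t, IntervalIntegrable (fun τ => interaction (w τ) τ (a τ)) volume 0 t)
    (heq : ∀ t, a t = a 0 + ∫ τ in (0 : ℝ)..t, interaction (w τ) τ (a τ))
    (hV : ∀ᵐ τ ∂volume.restrict I, V τ = w τ) : IsSolution I V fun t => free t (a t) where
  continuousOn := (continuous_free_apply continuous_id ha).continuousOn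
  duhamel := by
    refine ⟨fun τ => potentialOp (w τ) (free τ (a τ)), ?_, fun t _ => ?_⟩
    · filter_upwards [hV] with τ hτ
      simpa only [hτ] using coeFn_potentialOp (w τ) (free τ (a τ))
    have hshift (τ : ℝ) : freePropagator (t - τ) (potentialOp (w τ) (free τ (a τ)))
        = (-Complex.I) • free t (interaction (w τ) τ (a τ)) := by
      rw [freePropagator_eq_free, sub_eq_add_neg, free_add, interaction_apply, map_smul, smul_smul]
      simp
    have hfree : ∫ τ in (0 : ℝ)..t, free t (interaction (w τ) τ (a τ))
        = free t (∫ τ in (0 : ℝ)..t, interaction (w τ) τ (a τ)) :=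
      (free t).toContinuousLinearMap.intervalIntegral_comp_comm (hint t)
    have hfree_int : IntervalIntegrable (fun τ => free t (interaction (w τ) τ (a τ))) volume 0 t :=
      ⟨(free t).toContinuousLinearMap.integrable_comp (hint t).1,
        (free t).toContinuousLinearMap.integrable_comp (hint t).2⟩
    simp_rw [hshift]
    refine ⟨hfree_int.smul (-Complex.I), ?_⟩
    rw [intervalIntegral.integral_smul, smul_smul, freePropagator_eq_free, free_zero, hfree,
      heq t, map_add]
    simp

end IsSolution

/-! ### Linear evolution equations -/

section LinearODE

variable {𝕜 E : Type*} [NontriviallyNormedField 𝕜] [NormedAddCommGroup E] [NormedSpace 𝕜 E]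

/-- A strongly continuous family of operators whose norms are bounded by `M`. -/
structure IsBoundedFamily (B : ℝ → E →L[𝕜] E) (M : ℝ≥0) : Prop where
  continuous_apply : ∀ x, Continuous fun t => B t x
  norm_le : ∀ t, ‖B t‖ ≤ M

theorem integral_cosh_mul_sub {κ : ℝ} (hκ : κ ≠ 0) (s t : ℝ) :
    ∫ τ in s..t, Real.cosh (κ * (τ - s)) = κ⁻¹ * Real.sinh (κ * (t - s)) := by
  have hderiv (τ : ℝ) : HasDerivAt (fun τ => κ⁻¹ * Real.sinh (κ * (τ - s)))
      (Real.cosh (κ * (τ - s))) τ := by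
    convert! ((((hasDerivAt_id τ).sub_const s).const_mul κ).sinh).const_mul κ⁻¹ using 1
    simp
    field_simp
  rw [intervalIntegral.integral_eq_sub_of_hasDerivAt (fun τ _ => hderiv τ)
    (Continuous.intervalIntegrable (by fun_prop) _ _)]
  simp

namespace IsBoundedFamily

variable {B : ℝ → E →L[𝕜] E} {M : ℝ≥0}

theorem continuous_comp (hB : IsBoundedFamily B M) {a : ℝ → E} (ha : Continuous a) :
    Continuous fun t => B t (a t) :=
  continuous_apply_of_norm_le hB.norm_le hB.continuous_apply ha

variable [NormedSpace ℝ E]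

theorem norm_integral_cosh_smul_le (hB : IsBoundedFamily B M) {b : ℝ → E} {C κ : ℝ} (hκ : 0 < κ)
    (hb : ∀ t, ‖b t‖ ≤ C) (s t : ℝ) :
    ‖∫ τ in s..t, B τ (Real.cosh (κ * (τ - s)) • b τ)‖ ≤ M * C / κ * Real.cosh (κ * (t - s)) := by
  have hC : 0 ≤ C := (norm_nonneg _).trans (hb 0)
  have hpointwise (τ : ℝ) : ‖B τ (Real.cosh (κ * (τ - s)) • b τ)‖
      ≤ M * C * Real.cosh (κ * (τ - s)) := by
    refine ((B τ).le_of_opNorm_le (hB.norm_le τ) _).trans ?_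
    rw [norm_smul, Real.norm_of_nonneg (Real.cosh_pos _).le, mul_assoc, mul_comm C]
    gcongr
    exact hb τ
  calc ‖∫ τ in s..t, B τ (Real.cosh (κ * (τ - s)) • b τ)‖
      ≤ |∫ τ in s..t, M * C * Real.cosh (κ * (τ - s))| :=
        intervalIntegral.norm_integral_le_abs_of_norm_le (Eventually.of_forall hpointwise)
          (Continuous.intervalIntegrable (by fun_prop) _ _)
    _ = M * C / κ * |Real.sinh (κ * (t - s))| := by
        rw [intervalIntegral.integral_const_mul, integral_cosh_mul_sub hκ.ne', ← mul_assoc,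
          ← div_eq_mul_inv, abs_mul, abs_of_nonneg (by positivity)]
    _ ≤ M * C / κ * Real.cosh (κ * (t - s)) := by
        gcongr
        rw [Real.abs_sinh, ← Real.cosh_abs (κ * (t - s))]
        exact (Real.sinh_lt_cosh _).le

theorem norm_inv_cosh_smul_integral_le (hB : IsBoundedFamily B M) {κ : ℝ} (hκ : 0 < κ) (s t : ℝ)
    (b : ℝ →ᵇ E) :
    ‖(Real.cosh (κ * (t - s)))⁻¹ • ∫ τ in s..t, B τ (Real.cosh (κ * (τ - s)) • b τ)‖
      ≤ M * ‖b‖ / κ := by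
  rw [norm_smul, norm_inv, Real.norm_of_nonneg (Real.cosh_pos _).le,
    inv_mul_le_iff₀ (Real.cosh_pos _), mul_comm (Real.cosh _)]
  exact hB.norm_integral_cosh_smul_le hκ b.norm_coe_le_norm s t

theorem continuous_apply_cosh_smul (hB : IsBoundedFamily B M) (κ s : ℝ) (b : ℝ →ᵇ E) :
    Continuous fun τ => B τ (Real.cosh (κ * (τ - s)) • b τ) :=
  hB.continuous_comp (by fun_prop)

/-- The Picard map of `a' = B(t) a`, `a(s) = x`, for the unknown `b = a / cosh(κ(· - s))`. The
weight makes it a contraction of the bounded functions on the whole line as soon as `M < κ`. -/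
def picardMap (hB : IsBoundedFamily B M) {κ : ℝ} (hκ : 0 < κ) (s : ℝ) (x : E) (b : ℝ →ᵇ E) :
    ℝ →ᵇ E :=
  BoundedContinuousFunction.ofNormedAddCommGroup
    (fun t => (Real.cosh (κ * (t - s)))⁻¹ •
      (x + ∫ τ in s..t, B τ (Real.cosh (κ * (τ - s)) • b τ)))
    (Continuous.smul (Continuous.inv₀ (by fun_prop) fun t => (Real.cosh_pos _).ne')
      (continuous_const.add (intervalIntegral.continuous_primitive
        (fun _ _ => (hB.continuous_apply_cosh_smul κ s b).intervalIntegrable _ _) s)))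
    (‖x‖ + M * ‖b‖ / κ) fun t => by
      rw [smul_add]
      refine (norm_add_le _ _).trans
        (add_le_add ?_ (hB.norm_inv_cosh_smul_integral_le hκ s t b))
      rw [norm_smul, norm_inv, Real.norm_of_nonneg (Real.cosh_pos _).le]
      exact mul_le_of_le_one_left (norm_nonneg _) (inv_le_one_of_one_le₀ (Real.one_le_cosh _))

theorem picardMap_apply (hB : IsBoundedFamily B M) {κ : ℝ} (hκ : 0 < κ) (s : ℝ) (x : E)
    (b : ℝ →ᵇ E) (t : ℝ) :
    hB.picardMap hκ s x b t = (Real.cosh (κ * (t - s)))⁻¹ •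
      (x + ∫ τ in s..t, B τ (Real.cosh (κ * (τ - s)) • b τ)) := rfl

theorem lipschitzWith_picardMap (hB : IsBoundedFamily B M) {κ : ℝ≥0} (hκ : 0 < (κ : ℝ)) (s : ℝ)
    (x : E) : LipschitzWith (M / κ) (hB.picardMap hκ s x) := by
  refine LipschitzWith.of_dist_le_mul fun b c => ?_
  rw [BoundedContinuousFunction.dist_le (by positivity)]
  intro t
  have hsub : hB.picardMap hκ s x b t - hB.picardMap hκ s x c t
      = (Real.cosh (κ * (t - s)))⁻¹ •
        ∫ τ in s..t, B τ (Real.cosh (κ * (τ - s)) • (b - c) τ) := by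
    rw [picardMap_apply, picardMap_apply, ← smul_sub, add_sub_add_left_eq_sub,
      ← intervalIntegral.integral_sub
        ((hB.continuous_apply_cosh_smul κ s b).intervalIntegrable _ _)
        ((hB.continuous_apply_cosh_smul κ s c).intervalIntegrable _ _)]
    simp only [BoundedContinuousFunction.coe_sub, Pi.sub_apply, smul_sub, map_sub]
  rw [dist_eq_norm, hsub, dist_eq_norm, NNReal.coe_div, div_mul_eq_mul_div]
  exact hB.norm_inv_cosh_smul_integral_le hκ s t (b - c)

theorem exists_hasDerivAt [CompleteSpace E] (hB : IsBoundedFamily B M) (s : ℝ) (x : E) :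
    ∃ a : ℝ → E, a s = x ∧ ∀ t, HasDerivAt a (B t (a t)) t := by
  have hκ : 0 < ((M + 1 : ℝ≥0) : ℝ) := by positivity
  have hcontr : ContractingWith (M / (M + 1)) (hB.picardMap hκ s x) :=
    ⟨(div_lt_one (by positivity)).2 (lt_add_one M), hB.lipschitzWith_picardMap hκ s x⟩
  obtain ⟨b, hb⟩ : ∃ b, hB.picardMap hκ s x b = b := ⟨_, hcontr.fixedPoint_isFixedPt⟩
  set φ : ℝ → ℝ := fun t => Real.cosh (((M + 1 : ℝ≥0) : ℝ) * (t - s))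
  have hintegral (t : ℝ) : φ t • b t = x + ∫ τ in s..t, B τ (φ τ • b τ) := by
    have hfixed := (hB.picardMap_apply hκ s x b t).symm.trans (congrArg (· t) hb)
    exact ((inv_smul_eq_iff₀ (Real.cosh_pos _).ne').1 hfixed).symm
  refine ⟨fun t => φ t • b t, by simp [hintegral s], fun t => ?_⟩
  exact (((hB.continuous_apply_cosh_smul _ s b).integral_hasStrictDerivAt s t).hasDerivAt.const_add
    x).congr_of_eventuallyEq (Eventually.of_forall hintegral)

end IsBoundedFamily

end LinearODE

section SkewFamily

variable {𝕜 E : Type*} [RCLike 𝕜] [NormedAddCommGroup E] [InnerProductSpace 𝕜 E]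

/-- A strongly continuous family of skew-adjoint operators whose norms are bounded by `M`. -/
structure IsSkewFamily (B : ℝ → E →L[𝕜] E) (M : ℝ≥0) : Prop extends IsBoundedFamily B M where
  re_inner : ∀ t x, RCLike.re ⟪x, B t x⟫_𝕜 = 0

namespace IsSkewFamily

variable {B : ℝ → E →L[𝕜] E} {M : ℝ≥0} [NormedSpace ℝ E]

theorem norm_eq (hB : IsSkewFamily B M) {a : ℝ → E} (ha : ∀ t, HasDerivAt a (B t (a t)) t)
    (s t : ℝ) : ‖a s‖ = ‖a t‖ := by
  have hderiv (t : ℝ) : HasDerivAt (fun t => ⟪a t, a t⟫_𝕜) 0 t := by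
    have hskew : ⟪a t, B t (a t)⟫_𝕜 + ⟪B t (a t), a t⟫_𝕜 = 0 := by
      rw [← inner_conj_symm (B t (a t)) (a t), RCLike.add_conj, hB.re_inner]
      simp
    simpa only [hskew] using (ha t).inner 𝕜 (ha t)
  have hconst := is_const_of_deriv_eq_zero (fun t => (hderiv t).differentiableAt)
    (fun t => (hderiv t).deriv) s t
  simp only [inner_self_eq_norm_sq_to_K] at hconst
  exact (sq_eq_sq₀ (norm_nonneg _) (norm_nonneg _)).1 (by exact_mod_cast hconst)

theorem eq_of_apply_eq (hB : IsSkewFamily B M) {a b : ℝ → E}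
    (ha : ∀ t, HasDerivAt a (B t (a t)) t) (hb : ∀ t, HasDerivAt b (B t (b t)) t) {s : ℝ}
    (h : a s = b s) : a = b := by
  funext t
  have hsub (t : ℝ) : HasDerivAt (a - b) (B t ((a - b) t)) t := by
    rw [Pi.sub_apply, map_sub]
    exact (ha t).sub (hb t)
  have hnorm : ‖(a - b) t‖ = ‖(a - b) s‖ := hB.norm_eq hsub t s
  rw [Pi.sub_apply, Pi.sub_apply, h, sub_self, norm_zero, norm_eq_zero] at hnorm
  exact sub_eq_zero.1 hnorm

variable [CompleteSpace E]

/-- The solution of `a' = B(t) a`, `a(s) = x`. -/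
def evol (hB : IsSkewFamily B M) (s : ℝ) (x : E) : ℝ → E := (hB.exists_hasDerivAt s x).choose

theorem evol_self (hB : IsSkewFamily B M) (s : ℝ) (x : E) : hB.evol s x s = x :=
  (hB.exists_hasDerivAt s x).choose_spec.1

theorem hasDerivAt_evol (hB : IsSkewFamily B M) (s : ℝ) (x : E) (t : ℝ) :
    HasDerivAt (hB.evol s x) (B t (hB.evol s x t)) t :=
  (hB.exists_hasDerivAt s x).choose_spec.2 t

theorem continuous_evol (hB : IsSkewFamily B M) (s : ℝ) (x : E) : Continuous (hB.evol s x) :=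
  continuous_iff_continuousAt.2 fun t => (hB.hasDerivAt_evol s x t).continuousAt

theorem norm_evol (hB : IsSkewFamily B M) (s : ℝ) (x : E) (t : ℝ) : ‖hB.evol s x t‖ = ‖x‖ := by
  rw [hB.norm_eq (hB.hasDerivAt_evol s x) t s, hB.evol_self]

theorem evol_eq (hB : IsSkewFamily B M) {a : ℝ → E} (ha : ∀ t, HasDerivAt a (B t (a t)) t)
    (s : ℝ) : hB.evol s (a s) = a :=
  hB.eq_of_apply_eq (hB.hasDerivAt_evol _ _) ha (hB.evol_self _ _)

/-- The solution operator of `a' = B(t) a` from time `s` to time `t`. -/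
def flow (hB : IsSkewFamily B M) (s t : ℝ) : E ≃ E where
  toFun x := hB.evol s x t
  invFun y := hB.evol t y s
  left_inv x := by beta_reduce; rw [hB.evol_eq (hB.hasDerivAt_evol s x), hB.evol_self]
  right_inv y := by beta_reduce; rw [hB.evol_eq (hB.hasDerivAt_evol t y), hB.evol_self]

theorem norm_apply_evol_le (hB : IsSkewFamily B M) {s t δ : ℝ} {x : E}
    (hx : ∀ τ ∈ Set.Icc s t, ‖B τ x‖ ≤ δ) {τ : ℝ} (hτ : τ ∈ Set.Icc s t) :
    ‖B τ (hB.evol s x τ)‖ ≤ δ * Real.exp ((M + 1) * (t - s)) := by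
  have hM : (M : ℝ) + 1 ≠ 0 := by positivity
  have hδ : 0 ≤ δ := (norm_nonneg _).trans (hx τ hτ)
  have hspeed : ∀ τ ∈ Set.Icc s t,
      ‖B τ (hB.evol s x τ)‖ ≤ (M + 1) * ‖hB.evol s x τ - x‖ + δ := by
    intro τ hτ
    rw [← sub_add_cancel (hB.evol s x τ) x, map_add, add_sub_cancel_right]
    refine (norm_add_le _ _).trans (add_le_add ?_ (hx τ hτ))
    exact (B τ).le_of_opNorm_le ((hB.norm_le τ).trans (le_add_of_nonneg_right zero_le_one)) _
  have hgronwall := norm_le_gronwallBound_of_norm_deriv_right_le (δ := 0)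
    ((hB.continuous_evol s x).sub continuous_const).continuousOn
    (fun τ _ => ((hB.hasDerivAt_evol s x τ).sub_const x).hasDerivWithinAt)
    (by simp [hB.evol_self]) (fun τ hτ => hspeed τ (Set.Ico_subset_Icc_self hτ)) τ hτ
  rw [gronwallBound_of_K_ne_0 hM] at hgronwall
  calc ‖B τ (hB.evol s x τ)‖
      ≤ (M + 1) * ‖hB.evol s x τ - x‖ + δ := hspeed τ hτ
    _ ≤ (M + 1) * (0 * Real.exp ((M + 1) * (τ - s))
          + δ / (M + 1) * (Real.exp ((M + 1) * (τ - s)) - 1)) + δ := by gcongr; exact hgronwall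
    _ = δ * Real.exp ((M + 1) * (τ - s)) := by field_simp; ring
    _ ≤ δ * Real.exp ((M + 1) * (t - s)) := by gcongr; exact hτ.2

end IsSkewFamily

end SkewFamily

/-! ### Concatenation of evolutions -/

section PiecewiseIco

variable {α β : Type*} [Zero α] [Zero β] {t : ℕ → ℝ} {τ : ℝ}

open scoped Classical in
/-- The function that is `F j` on `[t j, t (j + 1))` and zero elsewhere. -/
def piecewiseIco (t : ℕ → ℝ) (F : ℕ → ℝ → α) (τ : ℝ) : α :=
  if h : ∃ j, τ ∈ Set.Ico (t j) (t (j + 1)) then F (Nat.find h) τ else 0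

theorem piecewiseIco_of_mem (ht : Monotone t) (F : ℕ → ℝ → α) {j : ℕ}
    (hj : τ ∈ Set.Ico (t j) (t (j + 1))) : piecewiseIco t F τ = F j τ := by
  classical
  have h : ∃ j, τ ∈ Set.Ico (t j) (t (j + 1)) := ⟨j, hj⟩
  have hfind : Nat.find h = j := by
    by_contra hne
    exact Set.disjoint_left.1 (ht.pairwise_disjoint_on_Ico_succ hne) (Nat.find_spec h) hj
  rw [piecewiseIco, dif_pos h, hfind]

theorem piecewiseIco_of_notMem (F : ℕ → ℝ → α) (h : ∀ j, τ ∉ Set.Ico (t j) (t (j + 1))) :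
    piecewiseIco t F τ = 0 := by
  rw [piecewiseIco, dif_neg (not_exists.2 h)]

theorem piecewiseIco_comp (g : ℝ → α → β) (hg : ∀ τ, g τ 0 = 0) (t : ℕ → ℝ) (F : ℕ → ℝ → α)
    (τ : ℝ) : piecewiseIco t (fun j τ => g τ (F j τ)) τ = g τ (piecewiseIco t F τ) := by
  by_cases h : ∃ j, τ ∈ Set.Ico (t j) (t (j + 1))
  · simp only [piecewiseIco, dif_pos h]
  · simp only [piecewiseIco, dif_neg h, hg]

theorem integrable_piecewiseIco {E : Type*} [NormedAddCommGroup E] (ht : Monotone t)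
    {F : ℕ → ℝ → E} (hF : ∀ j, Continuous (F j)) {C : ℕ → ℝ}
    (hC : Summable fun j => (t (j + 1) - t j) * C j)
    (hle : ∀ᶠ j in atTop, ∀ τ ∈ Set.Ico (t j) (t (j + 1)), ‖F j τ‖ ≤ C j) :
    Integrable (piecewiseIco t F) := by
  have hpieces : IntegrableOn (piecewiseIco t F) (⋃ j, Set.Ico (t j) (t (j + 1))) := by
    refine integrableOn_iUnion_of_summable_integral_norm (fun j => ?_) ?_
    · exact ((hF j).continuousOn.integrableOn_Icc.mono_set Set.Ico_subset_Icc_self).congr_fun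
        (fun τ hτ => (piecewiseIco_of_mem ht F hτ).symm) measurableSet_Ico
    · refine hC.of_norm_bounded_eventually_nat ?_
      filter_upwards [hle] with j hj
      refine (norm_setIntegral_le_of_norm_le_const (C := C j) (by simp) fun τ hτ => ?_).trans_eq ?_
      · rw [norm_norm, piecewiseIco_of_mem ht F hτ]
        exact hj τ hτ
      · rw [Real.volume_real_Ico_of_le (ht j.le_succ), mul_comm]
  refine hpieces.integrable_of_forall_notMem_eq_zero fun τ hτ => piecewiseIco_of_notMem F ?_
  simpa using hτ

end PiecewiseIco

section Concatenation

variable {𝕜 E : Type*} [RCLike 𝕜] [NormedAddCommGroup E] [InnerProductSpace 𝕜 E] [NormedSpace ℝ E]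
  [CompleteSpace E] {B : ℕ → ℝ → E →L[𝕜] E} {M : ℕ → ℝ≥0}

/-- The solution operator from time `t 0` to time `t j` of the equation that is driven by `B i`
during `[t i, t (i + 1))`. -/
def propagator (hB : ∀ j, IsSkewFamily (B j) (M j)) (t : ℕ → ℝ) : ℕ → E ≃ E
  | 0 => Equiv.refl E
  | j + 1 => (propagator hB t j).trans ((hB j).flow (t j) (t (j + 1)))

theorem propagator_succ_apply (hB : ∀ j, IsSkewFamily (B j) (M j)) (t : ℕ → ℝ) (j : ℕ) (x : E) :
    propagator hB t (j + 1) x = (hB j).evol (t j) (propagator hB t j x) (t (j + 1)) := rfl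

theorem propagator_congr {B' : ℕ → ℝ → E →L[𝕜] E} (hB : ∀ j, IsSkewFamily (B j) (M j))
    (hB' : ∀ j, IsSkewFamily (B' j) (M j)) (t : ℕ → ℝ) {j : ℕ} (h : ∀ i < j, B i = B' i) :
    propagator hB t j = propagator hB' t j := by
  induction j with
  | zero => rfl
  | succ j ih =>
    rw [propagator, propagator, ih fun i hi => h i (hi.trans j.lt_succ_self)]
    congr 2
    exact h j j.lt_succ_self

theorem norm_propagator (hB : ∀ j, IsSkewFamily (B j) (M j)) (t : ℕ → ℝ) (j : ℕ) (x : E) :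
    ‖propagator hB t j x‖ = ‖x‖ := by
  induction j with
  | zero => rfl
  | succ j ih => rw [propagator_succ_apply, (hB j).norm_evol, ih]

/-- The derivative of the solution with value `x` at time `t 0` of the equation that is driven by
`B j` during `[t j, t (j + 1))` and stationary outside these intervals. -/
def concatDeriv (hB : ∀ j, IsSkewFamily (B j) (M j)) (t : ℕ → ℝ) (x : E) : ℝ → E :=
  piecewiseIco t fun j τ => B j τ ((hB j).evol (t j) (propagator hB t j x) τ)

/-- The primitive of `concatDeriv` with value `x` at time `0`. -/
def concat (hB : ∀ j, IsSkewFamily (B j) (M j)) (t : ℕ → ℝ) (x : E) (τ : ℝ) : E :=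
  x + ∫ σ in (0 : ℝ)..τ, concatDeriv hB t x σ

variable {hB : ∀ j, IsSkewFamily (B j) (M j)} {t : ℕ → ℝ} {x : E}

theorem continuous_apply_evol (hB : ∀ j, IsSkewFamily (B j) (M j)) (t : ℕ → ℝ) (x : E) (j : ℕ) :
    Continuous fun τ => B j τ ((hB j).evol (t j) (propagator hB t j x) τ) :=
  (hB j).continuous_comp ((hB j).continuous_evol _ _)

theorem integrable_concatDeriv (ht : Monotone t) {δ : ℕ → ℝ}
    (hδ : Summable fun j =>
      (t (j + 1) - t j) * (δ j * Real.exp ((M j + 1) * (t (j + 1) - t j))))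
    (hsmall : ∀ᶠ j in atTop, ∀ τ ∈ Set.Icc (t j) (t (j + 1)),
      ‖B j τ (propagator hB t j x)‖ ≤ δ j) : Integrable (concatDeriv hB t x) :=
  integrable_piecewiseIco ht (continuous_apply_evol hB t x) hδ <| hsmall.mono fun j hj _ hτ =>
    (hB j).norm_apply_evol_le hj (Set.Ico_subset_Icc_self hτ)

theorem concat_zero : concat hB t x 0 = x := by
  rw [concat, intervalIntegral.integral_same, add_zero]

theorem continuous_concat (hint : Integrable (concatDeriv hB t x)) :
    Continuous (concat hB t x) :=
  continuous_const.add
    (intervalIntegral.continuous_primitive (fun _ _ => hint.intervalIntegrable) 0)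

theorem concat_eq_add_integral (hint : Integrable (concatDeriv hB t x)) (s τ : ℝ) :
    concat hB t x τ = concat hB t x s + ∫ σ in s..τ, concatDeriv hB t x σ := by
  rw [concat, concat, add_assoc, intervalIntegral.integral_add_adjacent_intervals
    hint.intervalIntegrable hint.intervalIntegrable]

theorem concat_eq_evol_of_node (ht : Monotone t) (hint : Integrable (concatDeriv hB t x)) {j : ℕ}
    (hj : concat hB t x (t j) = propagator hB t j x) {τ : ℝ}
    (hτ : τ ∈ Set.Icc (t j) (t (j + 1))) :
    concat hB t x τ = (hB j).evol (t j) (propagator hB t j x) τ := by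
  have hpiece : ∫ σ in t j..τ, concatDeriv hB t x σ
      = ∫ σ in t j..τ, B j σ ((hB j).evol (t j) (propagator hB t j x) σ) :=
    intervalIntegral.integral_congr_Ioo_of_le hτ.1 fun σ hσ =>
      piecewiseIco_of_mem ht _ ⟨hσ.1.le, hσ.2.trans_le hτ.2⟩
  rw [concat_eq_add_integral hint (t j), hpiece,
    intervalIntegral.integral_eq_sub_of_hasDerivAt (fun σ _ => (hB j).hasDerivAt_evol _ _ σ)
      ((continuous_apply_evol hB t x j).intervalIntegrable _ _), hj, (hB j).evol_self]
  abel

theorem concat_node (ht : Monotone t) (ht0 : t 0 = 0) (hint : Integrable (concatDeriv hB t x))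
    (j : ℕ) : concat hB t x (t j) = propagator hB t j x := by
  induction j with
  | zero => rw [ht0, concat_zero, propagator, Equiv.refl_apply]
  | succ j ih => exact concat_eq_evol_of_node ht hint ih ⟨ht j.le_succ, le_rfl⟩

theorem concat_eq_evol (ht : Monotone t) (ht0 : t 0 = 0)
    (hint : Integrable (concatDeriv hB t x)) {j : ℕ} {τ : ℝ}
    (hτ : τ ∈ Set.Icc (t j) (t (j + 1))) :
    concat hB t x τ = (hB j).evol (t j) (propagator hB t j x) τ :=
  concat_eq_evol_of_node ht hint (concat_node ht ht0 hint j) hτ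

theorem concatDeriv_eq (ht : Monotone t) (ht0 : t 0 = 0)
    (hint : Integrable (concatDeriv hB t x)) (τ : ℝ) :
    concatDeriv hB t x τ = piecewiseIco t B τ (concat hB t x τ) := by
  by_cases h : ∃ j, τ ∈ Set.Ico (t j) (t (j + 1))
  · obtain ⟨j, hj⟩ := h
    rw [concatDeriv, piecewiseIco_of_mem ht _ hj, piecewiseIco_of_mem ht _ hj,
      concat_eq_evol ht ht0 hint (Set.Ico_subset_Icc_self hj)]
  · rw [not_exists] at h
    rw [concatDeriv, piecewiseIco_of_notMem _ h, piecewiseIco_of_notMem _ h,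
      zero_apply]

theorem exists_seq_of_forall_congr {ι : Type*} [Nonempty ι] {Q : ℕ → (ℕ → ι) → ι → Prop}
    (hQ : ∀ j c, ∃ i, Q j c i)
    (hcongr : ∀ j c c', (∀ i < j, c i = c' i) → ∀ i, Q j c i → Q j c' i) :
    ∃ c : ℕ → ι, ∀ j, Q j c (c j) := by
  choose pick hpick using hQ
  let extend (j : ℕ) (c : ∀ i < j, ι) (i : ℕ) : ι :=
    if h : i < j then c i h else Classical.arbitrary ι
  let c : ℕ → ι := wellFounded_lt.fix fun j c => pick j (extend j c)
  have hc (j : ℕ) : c j = pick j (extend j fun i _ => c i) := wellFounded_lt.fix_eq _ j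
  refine ⟨c, fun j => hcongr j (extend j fun i _ => c i) c (fun i hi => dif_pos hi) _ ?_⟩
  rw [hc]
  exact hpick j _

theorem exists_pos_summable_mul {K : ℕ → ℝ} (hK : ∀ j, 0 ≤ K j) :
    ∃ δ : ℕ → ℝ, (∀ j, 0 < δ j) ∧ Summable fun j => δ j * K j := by
  refine ⟨fun j => (1 / 2) ^ j / (K j + 1), fun j => have := hK j; by positivity, ?_⟩
  refine Summable.of_nonneg_of_le (fun j => have := hK j; by positivity) (fun j => ?_)
    summable_geometric_two
  have := hK j
  rw [div_mul_eq_mul_div, div_le_iff₀ (by positivity)]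
  gcongr
  exact le_add_of_nonneg_right zero_le_one

/-- The `j`-th generator is chosen so small on the solutions that follow `φ k` during the `k`-th
interval, `k < j`, that each of these solutions has an integrable derivative. -/
theorem exists_seq_integrable_concatDeriv {ι : Type*} {l : Filter ι} [l.NeBot] (ht : Monotone t)
    {B : ℕ → ι → ℝ → E →L[𝕜] E} (hB : ∀ j c, IsSkewFamily (B j c) (M j))
    (hsmall : ∀ j x, ∀ δ > 0, ∀ᶠ c in l, ∀ τ ∈ Set.Icc (t j) (t (j + 1)), ‖B j c τ x‖ ≤ δ)
    (φ : ℕ → ι → E) :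
    ∃ c : ℕ → ι, ∀ k, Integrable (concatDeriv (fun j => hB j (c j)) t
      ((propagator (fun j => hB j (c j)) t k).symm (φ k (c k)))) := by
  have : Nonempty ι := l.nonempty_of_neBot
  obtain ⟨δ, hδ_pos, hδ⟩ := exists_pos_summable_mul fun j => mul_nonneg
    (sub_nonneg.2 (ht j.le_succ)) (Real.exp_pos ((M j + 1) * (t (j + 1) - t j))).le
  let P (c : ℕ → ι) : ℕ → E ≃ E := propagator (fun j => hB j (c j)) t
  obtain ⟨c, hc⟩ := exists_seq_of_forall_congr
    (Q := fun j c i => ∀ k ∈ Finset.range j, ∀ τ ∈ Set.Icc (t j) (t (j + 1)),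
      ‖B j i τ (P c j ((P c k).symm (φ k (c k))))‖ ≤ δ j)
    (fun j c => ((Finset.eventually_all (Finset.range j)).2 fun k _ =>
      hsmall j _ (δ j) (hδ_pos j)).exists)
    (fun j c c' hcc' i hi k hk => by
      have hk' := Finset.mem_range.1 hk
      have hP (m : ℕ) (hm : m ≤ j) : P c m = P c' m :=
        propagator_congr _ _ t fun i hi => by rw [hcc' i (hi.trans_le hm)]
      rw [← hP j le_rfl, ← hP k hk'.le, ← hcc' k hk']
      exact hi k hk)
  refine ⟨c, fun k => integrable_concatDeriv ht (by simpa only [mul_left_comm] using hδ) ?_⟩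
  filter_upwards [eventually_gt_atTop k] with j hj using hc j k (Finset.mem_range.2 hj)

end Concatenation

/-! ### Rescaled potentials -/

section Rescale

variable {E F : Type*} [NormedAddCommGroup E] [InnerProductSpace ℝ E]

/-- The function `x ↦ f((x - c)/ε)`. -/
def rescale (ε : ℝ) (c : E) (f : E → F) (x : E) : F :=
  f (ε⁻¹ • (x - c))

/-- The bounded potential `x ↦ ε⁻² w((x - c)/ε)`, for which `-Δ + w` and its bound states are
transported by `rescale ε c`. -/
def scaledPotential (w : E →ᵇ ℝ) (ε : ℝ) (c : E) : E →ᵇ ℝ :=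
  ε⁻¹ ^ 2 • w.compContinuous ⟨fun x => ε⁻¹ • (x - c), by fun_prop⟩

theorem coe_scaledPotential (w : E →ᵇ ℝ) (ε : ℝ) (c : E) :
    (scaledPotential w ε c : E → ℝ) = ε⁻¹ ^ 2 • rescale ε c w := rfl

theorem norm_scaledPotential_le (w : E →ᵇ ℝ) (ε : ℝ) (c : E) :
    ‖scaledPotential w ε c‖ ≤ ε⁻¹ ^ 2 * ‖w‖ := by
  rw [scaledPotential, norm_smul, Real.norm_of_nonneg (sq_nonneg _)]
  gcongr
  exact w.norm_compContinuous_le _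

theorem tendsto_rescale_cobounded [TopologicalSpace F] {ε : ℝ} (hε : ε ≠ 0) {f : E → F} {y : F}
    (hf : Tendsto f (Bornology.cobounded E) (𝓝 y)) (x : E) :
    Tendsto (fun c => rescale ε c f x) (Bornology.cobounded E) (𝓝 y) := by
  refine hf.comp (tendsto_norm_atTop_iff_cobounded.1 ?_)
  simp only [norm_smul]
  exact (tendsto_norm_cobounded_atTop.comp (tendsto_const_sub_cobounded x)).const_mul_atTop
    (norm_pos_iff.2 (inv_ne_zero hε))

theorem tendsto_scaledPotential_cobounded {ε : ℝ} (hε : ε ≠ 0) {w : E →ᵇ ℝ}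
    (hw : Tendsto w (Bornology.cobounded E) (𝓝 0)) (x : E) :
    Tendsto (fun c => scaledPotential w ε c x) (Bornology.cobounded E) (𝓝 0) := by
  simpa only [coe_scaledPotential, Pi.smul_apply, smul_zero]
    using (tendsto_rescale_cobounded hε hw x).const_smul (ε⁻¹ ^ 2)

theorem exists_schwartzMap_eq_rescale [NormedAddCommGroup F] [NormedSpace ℝ F] {ε : ℝ} (hε : 0 < ε)
    (c : E) (f : 𝓢(E, F)) : ∃ g : 𝓢(E, F), (g : E → F) = rescale ε c f := by
  have hgrowth : Function.HasTemperateGrowth fun x : E => ε⁻¹ • (x - c) :=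
    (ε⁻¹ • ContinuousLinearMap.id ℝ E).hasTemperateGrowth.comp (f := fun x => x - c) (by fun_prop)
  have hanti : AntilipschitzWith ε.toNNReal fun x : E => ε⁻¹ • (x - c) := by
    refine AntilipschitzWith.of_le_mul_dist fun x y => ?_
    rw [dist_smul₀, dist_sub_right, Real.coe_toNNReal ε hε.le, norm_inv, Real.norm_of_nonneg hε.le,
      mul_inv_cancel_left₀ hε.ne']
  exact ⟨SchwartzMap.compCLMOfAntilipschitz ℝ hgrowth hanti f, rfl⟩

theorem IsBoundState.rescale [FiniteDimensional ℝ E] {w : E →ᵇ ℝ} {lam : ℝ} {g : E → ℂ}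
    (hg : IsBoundState w lam g) (hsmooth : ContDiff ℝ 2 g) (ε : ℝ) (c : E) :
    IsBoundState (scaledPotential w ε c) (ε⁻¹ ^ 2 * lam) (rescale ε c g) := by
  intro x
  have hlaplacian : Δ (Schrodinger.rescale ε c g) x = ε⁻¹ ^ 2 • Δ g (ε⁻¹ • (x - c)) :=
    laplacian_comp_smul_sub hsmooth ε⁻¹ c x
  rw [hlaplacian, coe_scaledPotential, Pi.smul_apply, Complex.real_smul, smul_eq_mul]
  unfold Schrodinger.rescale
  push_cast
  linear_combination ((ε : ℂ)⁻¹ ^ 2) * hg (ε⁻¹ • (x - c))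

theorem eLpNorm_rescale [NormedAddCommGroup F] [FiniteDimensional ℝ E] [MeasurableSpace E]
    [BorelSpace E] (μ : Measure E) [μ.IsAddHaarMeasure] {ε : ℝ} (hε : 0 < ε) (c : E) (f : E → F)
    (q : ℝ≥0∞) :
    eLpNorm (rescale ε c f) q μ
      = ENNReal.ofReal ε ^ (Module.finrank ℝ E * (1 / q).toReal) * eLpNorm f q μ := by
  let e : E ≃ₜ E :=
    (Homeomorph.subRight c).trans (Homeomorph.smulOfNeZero ε⁻¹ (inv_ne_zero hε.ne'))
  have hmap : μ.map e = ENNReal.ofReal ε ^ Module.finrank ℝ E • μ := by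
    change μ.map ((ε⁻¹ • ·) ∘ (· - c)) = _
    rw [← Measure.map_map (by fun_prop) (by fun_prop), map_sub_right_eq_self,
      Measure.map_addHaar_smul _ (inv_ne_zero hε.ne'), ← ENNReal.ofReal_pow hε.le, inv_pow,
      inv_inv, abs_of_pos (by positivity)]
  have hcomp : eLpNorm (rescale ε c f) q μ = eLpNorm f q (μ.map e) :=
    (e.measurableEmbedding.eLpNorm_map_measure (g := f)).symm
  rw [hcomp, hmap, eLpNorm_smul_measure_of_ne_zero (pow_ne_zero _ (by simpa using hε)),
    smul_eq_mul, ENNReal.rpow_mul, ENNReal.rpow_natCast]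

end Rescale

theorem eLpNorm_smul_of_norm_eq_one {α : Type*} {m : MeasurableSpace α} {μ : Measure α}
    {p : ℝ≥0∞} {c : ℂ} (hc : ‖c‖ = 1) (f : Lp ℂ p μ) (q : ℝ≥0∞) :
    eLpNorm (c • f : Lp ℂ p μ) q μ = eLpNorm f q μ := by
  rw [eLpNorm_congr_ae (Lp.coeFn_smul c f), eLpNorm_const_smul, ← ofReal_norm, hc,
    ENNReal.ofReal_one, one_mul]

section StandingWave

variable {n : ℕ}

theorem isSkewFamily_interaction {w : Space n →ᵇ ℝ} {M : ℝ≥0} (hM : ‖w‖ ≤ M) :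
    IsSkewFamily (interaction w) M :=
  ⟨⟨continuous_interaction w, fun t => (norm_interaction_le w t).trans hM⟩,
    re_inner_interaction w⟩

theorem eventually_norm_interaction_scaledPotential_le {w : Space n →ᵇ ℝ}
    (hw : Tendsto w (Bornology.cobounded (Space n)) (𝓝 0)) {ε : ℝ} (hε : ε ≠ 0) (f : L2 n)
    (s t : ℝ) {δ : ℝ} (hδ : 0 < δ) :
    ∀ᶠ c in Bornology.cobounded (Space n), ∀ τ ∈ Set.Icc s t,
      ‖interaction (scaledPotential w ε c) τ f‖ ≤ δ := by
  have : (Bornology.cobounded (Space n)).IsCountablyGenerated := by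
    rw [← comap_norm_atTop]
    infer_instance
  have horbit : IsCompact ((fun τ => free τ f) '' Set.Icc s t) :=
    isCompact_Icc.image (continuous_free f)
  filter_upwards [eventually_forall_norm_le_of_isCompact
    (fun c => (norm_potentialOp_le _).trans (norm_scaledPotential_le w ε c))
    (tendsto_potentialOp_zero (by simp) (norm_scaledPotential_le w ε)
      (tendsto_scaledPotential_cobounded hε hw)) horbit hδ] with c hc τ hτ
  rw [norm_interaction_apply]
  exact hc _ ⟨τ, hτ, rfl⟩

theorem isSolution_concat {w : ℕ → Space n →ᵇ ℝ} {M : ℕ → ℝ≥0}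
    (hB : ∀ j, IsSkewFamily (interaction (w j)) (M j)) {t : ℕ → ℝ} (ht0 : t 0 = 0)
    (ht : Monotone t) {x : L2 n} (hint : Integrable (concatDeriv hB t x)) :
    IsSolution (Set.Ici 0) (piecewiseIco t fun j _ => w j)
      fun τ => free τ (concat hB t x τ) := by
  have hderiv : concatDeriv hB t x = fun τ =>
      interaction (piecewiseIco t (fun j _ => w j) τ) τ (concat hB t x τ) := by
    ext1 τ
    rw [concatDeriv_eq ht ht0 hint, piecewiseIco_comp (fun τ w => interaction w τ) fun τ =>
      norm_le_zero_iff.1 ((norm_interaction_le 0 τ).trans_eq norm_zero)]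
  refine isSolution_of_interaction (w := piecewiseIco t fun j _ => w j) (continuous_concat hint)
    (fun _ => ?_) (fun τ => ?_)
    (Eventually.of_forall fun τ =>
      piecewiseIco_comp (fun _ (w : Space n →ᵇ ℝ) => ⇑w) (fun _ => rfl) t _ τ)
  · rw [← hderiv]
    exact hint.intervalIntegrable
  · rw [← hderiv]
    exact concat_eq_add_integral hint 0 τ

/-- The centres `c j` are sent to infinity one after the other: the `k`-th solution hardly feels the
copies of the potential that are switched on after it. -/
theorem exists_isSolution_standingWave (hn : 0 < n) {w : Space n →ᵇ ℝ}
    (hw : Tendsto w (Bornology.cobounded (Space n)) (𝓝 0)) {g : 𝓢(Space n, ℂ)} {lam : ℝ}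
    (hg : IsBoundState w lam g) {ε : ℕ → ℝ} (hε : ∀ k, 0 < ε k) {t : ℕ → ℝ} (ht0 : t 0 = 0)
    (ht : Monotone t) :
    ∃ (c : ℕ → Space n) (u : ℕ → ℝ → L2 n), ∀ k,
      IsSolution (Set.Ici 0) (piecewiseIco t fun j _ => scaledPotential w (ε j) (c j)) (u k) ∧
      (∀ q, ∀ τ ∈ Set.Ico (t k) (t (k + 1)),
        eLpNorm (u k τ) q volume = eLpNorm (rescale (ε k) (c k) g) q volume) ∧
      ‖u k 0‖ₑ = eLpNorm (rescale (ε k) (c k) g) 2 volume := by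
  have : Nonempty (Fin n) := ⟨⟨0, hn⟩⟩
  have hB (j : ℕ) (c : Space n) : IsSkewFamily (interaction (scaledPotential w (ε j) c))
      ((ε j)⁻¹ ^ 2 * ‖w‖).toNNReal :=
    isSkewFamily_interaction ((norm_scaledPotential_le w (ε j) c).trans (Real.le_coe_toNNReal _))
  choose f hf using fun j c => exists_schwartzMap_eq_rescale (hε j) c g
  let φ (j : ℕ) (c : Space n) : ℝ → L2 n := boundStateWave ((ε j)⁻¹ ^ 2 * lam) ((f j c).toLp 2)
  have hφ (j : ℕ) (c : Space n) (τ : ℝ) :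
      HasDerivAt (φ j c) (interaction (scaledPotential w (ε j) c) τ (φ j c τ)) τ :=
    IsBoundState.hasDerivAt_boundStateWave (hf j c ▸ hg.rescale (g.smooth 2) (ε j) c) τ
  have hnorm (j : ℕ) (c : Space n) (q : ℝ≥0∞) :
      eLpNorm ((f j c).toLp 2 volume) q volume = eLpNorm (rescale (ε j) c g) q volume := by
    rw [eLpNorm_congr_ae ((f j c).coeFn_toLp 2 volume), hf]
  obtain ⟨c, hint⟩ := exists_seq_integrable_concatDeriv ht hB
    (fun j f δ hδ => eventually_norm_interaction_scaledPotential_le hw (hε j).ne' f _ _ hδ)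
    fun j c => φ j c (t j)
  let P : ℕ → L2 n ≃ L2 n := propagator (fun j => hB j (c j)) t
  refine ⟨c, fun k τ => free τ (concat (fun j => hB j (c j)) t ((P k).symm (φ k (c k) (t k))) τ),
    fun k => ⟨isSolution_concat _ ht0 ht (hint k), fun q τ hτ => ?_, ?_⟩⟩
  · beta_reduce
    rw [concat_eq_evol ht ht0 (hint k) (Set.Ico_subset_Icc_self hτ), Equiv.apply_symm_apply,
      (hB k (c k)).evol_eq (hφ k (c k)), free_boundStateWave,
      eLpNorm_smul_of_norm_eq_one (norm_exp_neg_I_mul _), hnorm]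
  · have hP : ‖(P k).symm (φ k (c k) (t k))‖ = ‖φ k (c k) (t k)‖ := by
      rw [← norm_propagator (fun j => hB j (c j)) t k, Equiv.apply_symm_apply]
    rw [← hnorm, ← Lp.enorm_def, ← ofReal_norm, ← ofReal_norm, (free 0).norm_map, concat_zero, hP,
      norm_boundStateWave]

end StandingWave

/-! ### Mixed norms -/

section MixedNorm

variable {n : ℕ} {t : ℕ → ℝ}

theorem aestronglyMeasurable_uncurry_piecewiseIco {X E : Type*} [MeasurableSpace X]
    [NormedAddCommGroup E] (ht : Monotone t) {F : ℕ → X → E} (hF : ∀ j, StronglyMeasurable (F j))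
    (μ : Measure (ℝ × X)) :
    AEStronglyMeasurable (Function.uncurry (piecewiseIco t fun j _ => F j)) μ := by
  have hmeas (j : ℕ) : MeasurableSet (Prod.fst ⁻¹' Set.Ico (t j) (t (j + 1)) : Set (ℝ × X)) :=
    measurable_fst measurableSet_Ico
  have hsupport : (⋃ j, Prod.fst ⁻¹' Set.Ico (t j) (t (j + 1))).indicator
      (Function.uncurry (piecewiseIco t fun j _ => F j))
        = Function.uncurry (piecewiseIco t fun j _ => F j) := by
    refine Set.indicator_eq_self.2 fun x hx => ?_
    by_contra hnot
    simp only [Set.mem_iUnion, Set.mem_preimage, not_exists] at hnot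
    exact hx (congrFun (piecewiseIco_of_notMem (fun j _ => F j) hnot) x.2)
  rw [← hsupport, aestronglyMeasurable_indicator_iff (.iUnion hmeas),
    aestronglyMeasurable_iUnion_iff]
  intro j
  refine ((hF j).comp_measurable measurable_snd).aestronglyMeasurable.congr ?_
  filter_upwards [ae_restrict_mem (hmeas j)] with x hx
  exact (congrFun (piecewiseIco_of_mem ht (fun j _ => F j) hx) x.2).symm

theorem lintegral_piecewiseIco (ht : Monotone t) (a : ℕ → ℝ≥0∞) :
    ∫⁻ τ, piecewiseIco t (fun j _ => a j) τ = ∑' j, ENNReal.ofReal (t (j + 1) - t j) * a j := by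
  have hsum : piecewiseIco t (fun j _ => a j)
      = fun τ => ∑' j, (Set.Ico (t j) (t (j + 1))).indicator (fun _ => a j) τ := by
    ext1 τ
    by_cases hτ : ∃ j, τ ∈ Set.Ico (t j) (t (j + 1))
    · obtain ⟨j, hj⟩ := hτ
      rw [piecewiseIco_of_mem ht _ hj, tsum_eq_single j, Set.indicator_of_mem hj]
      exact fun i hi => Set.indicator_of_notMem
        (Set.disjoint_right.1 (ht.pairwise_disjoint_on_Ico_succ hi) hj) _
    · rw [not_exists] at hτ
      simp only [piecewiseIco_of_notMem _ hτ, Set.indicator_of_notMem (hτ _), tsum_zero]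
  rw [hsum, lintegral_tsum fun j => (measurable_const.indicator measurableSet_Ico).aemeasurable]
  refine tsum_congr fun j => ?_
  rw [lintegral_indicator_const measurableSet_Ico, Real.volume_Ico, mul_comm]

theorem memMixed_piecewiseIco (I : Set ℝ) {r s : ℝ≥0∞} (hr0 : r ≠ 0) (hr : r ≠ ⊤)
    (ht : Monotone t) {F : ℕ → Space n → ℝ} (hF : ∀ j, StronglyMeasurable (F j))
    (hsum : ∑' j, ENNReal.ofReal (t (j + 1) - t j) * eLpNorm (F j) s volume ^ r.toReal ≠ ⊤) :
    MemMixed I r s (piecewiseIco t fun j _ => F j) := by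
  refine ⟨aestronglyMeasurable_uncurry_piecewiseIco ht hF _, ?_⟩
  rw [mixedNorm, eLpNorm_lt_top_iff_lintegral_rpow_enorm_lt_top hr0 hr]
  calc ∫⁻ τ in I, ‖eLpNorm (piecewiseIco t (fun j _ => F j) τ) s volume‖ₑ ^ r.toReal
      ≤ ∫⁻ τ, ‖eLpNorm (piecewiseIco t (fun j _ => F j) τ) s volume‖ₑ ^ r.toReal :=
        setLIntegral_le_lintegral _ _
    _ = ∫⁻ τ, piecewiseIco t (fun j _ => eLpNorm (F j) s volume ^ r.toReal) τ := by
        refine lintegral_congr fun τ => ?_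
        rw [enorm_eq_self, piecewiseIco_comp
          (fun _ (f : Space n → ℝ) => eLpNorm f s volume ^ r.toReal) fun _ => ?_]
        rw [eLpNorm_zero, ENNReal.zero_rpow_of_pos (ENNReal.toReal_pos hr0 hr)]
    _ < ⊤ := (lintegral_piecewiseIco ht _).trans_lt hsum.lt_top

theorem mul_rpow_le_mixedNorm {F : Type*} [NormedAddCommGroup F] {I : Set ℝ} {p q D : ℝ≥0∞}
    (hp0 : p ≠ 0) (hp : p ≠ ⊤) {f : ℝ → Space n → F} {a b : ℝ} (hI : Set.Ico a b ⊆ I)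
    (hD : ∀ τ ∈ Set.Ico a b, eLpNorm (f τ) q volume = D) :
    D * ENNReal.ofReal (b - a) ^ (1 / p).toReal ≤ mixedNorm I p q f :=
  calc D * ENNReal.ofReal (b - a) ^ (1 / p).toReal
      = eLpNorm (fun _ : ℝ => D) p (volume.restrict (Set.Ico a b)) := by
        rw [eLpNorm_const' _ hp0 hp]
        simp
    _ = eLpNorm (fun τ => eLpNorm (f τ) q volume) p (volume.restrict (Set.Ico a b)) := by
        refine eLpNorm_congr_ae ?_
        filter_upwards [ae_restrict_mem measurableSet_Ico] with τ hτ using (hD τ hτ).symm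
    _ ≤ mixedNorm I p q f := eLpNorm_mono_measure _ (Measure.restrict_mono hI le_rfl)

theorem strichartzNorm_standingWave {f : L2 n} {p q : ℝ≥0∞} (hp0 : p ≠ 0) (hp : p ≠ ⊤)
    (hf : eLpNorm f q volume ≠ 0) : strichartzNorm (Set.Ici 0) p q (standingWave f) = ⊤ := by
  have hconst (t : ℝ) : eLpNorm (standingWave f t) q volume = eLpNorm f q volume :=
    eLpNorm_smul_of_norm_eq_one (norm_exp_neg_I_mul t) f q
  simp only [strichartzNorm, mixedNorm, hconst]
  rw [eLpNorm_const' _ hp0 hp, Measure.restrict_apply_univ, Real.volume_Ici,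
    ENNReal.top_rpow_of_pos (one_div_pos.2 (ENNReal.toReal_pos hp0 hp)), enorm_eq_self,
    ENNReal.mul_top hf]

end MixedNorm

namespace Admissible

variable {n : ℕ} {p q : ℝ≥0∞}

theorem left_ne_zero (h : Admissible n p q) : p ≠ 0 := (two_pos.trans_le h.2.1).ne'

theorem right_ne_zero (h : Admissible n p q) : q ≠ 0 := (two_pos.trans_le h.2.2.1).ne'

theorem two_mul_add_mul_eq (h : Admissible n p q) :
    2 * (1 / p).toReal + n * (1 / q).toReal = n / 2 := by
  have hreal := congrArg ENNReal.toReal h.1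
  rw [ENNReal.toReal_add (by simpa using h.left_ne_zero)
    (ENNReal.div_ne_top (by simp) (by simp [h.right_ne_zero]))] at hreal
  simp only [ENNReal.toReal_div, ENNReal.toReal_mul, ENNReal.toReal_natCast,
    ENNReal.toReal_ofNat, ENNReal.toReal_one, mul_comm (2 : ℝ), ← div_div] at hreal ⊢
  linear_combination 2 * hreal

theorem left_ne_top (h : Admissible n p q) (hn : 0 < n) (hpq : (p, q) ≠ (⊤, 2)) : p ≠ ⊤ := by
  rintro rfl
  have hn' : (n : ℝ) ≠ 0 := by positivity
  have hq : (1 / q).toReal = (1 / 2 : ℝ≥0∞).toReal := by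
    refine mul_left_cancel₀ hn' ?_
    simpa [div_eq_mul_inv] using h.two_mul_add_mul_eq
  rw [ENNReal.toReal_eq_toReal_iff' (by simpa using h.right_ne_zero) (by simp), one_div,
    one_div, inv_inj] at hq
  exact hpq (congrArg _ hq)

end Admissible

section Scaling

variable {n : ℕ} {r s : ℝ≥0∞}

theorem eLpNorm_scaledPotential (w : Space n →ᵇ ℝ) {ε : ℝ} (hε : 0 < ε) (c : Space n)
    (s : ℝ≥0∞) :
    eLpNorm (scaledPotential w ε c) s volume
      = ENNReal.ofReal (ε ^ (n * (1 / s).toReal - 2)) * eLpNorm w s volume := by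
  rw [coe_scaledPotential, eLpNorm_const_smul, eLpNorm_rescale volume hε, ← mul_assoc,
    finrank_euclideanSpace_fin, Real.enorm_of_nonneg (by positivity),
    ENNReal.ofReal_rpow_of_pos hε, ← ENNReal.ofReal_mul (by positivity)]
  congr 2
  rw [Real.rpow_sub hε, Real.rpow_two]
  field_simp

/-- The exponent of `ε` in `‖V‖ ^ r`, where `‖V‖` is the norm in `L^r(I; L^s(ℝⁿ))` of a potential
`ε⁻² w((x - c)/ε)` that is switched on for a time proportional to `ε²`. -/
def potentialExponent (n : ℕ) (r s : ℝ≥0∞) : ℝ :=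
  2 + r.toReal * (n * (1 / s).toReal - 2)

theorem potentialExponent_eq (hr0 : r ≠ 0) (hr : r ≠ ⊤) (hs : s ≠ 0) :
    potentialExponent n r s
      = 2 * r.toReal * ((1 / r + (n : ℝ≥0∞) / (2 * s)).toReal - 1) := by
  have hr_pos : 0 < r.toReal := ENNReal.toReal_pos hr0 hr
  rw [potentialExponent, ENNReal.toReal_add (by simpa using hr0)
    (ENNReal.div_ne_top (by simp) (by simp [hs]))]
  simp only [ENNReal.toReal_div, ENNReal.toReal_mul, ENNReal.toReal_natCast,
    ENNReal.toReal_ofNat, ENNReal.toReal_one, mul_comm (2 : ℝ) s.toReal, ← div_div]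
  field_simp
  ring

theorem potentialExponent_ne_zero (hr0 : r ≠ 0) (hr : r ≠ ⊤) (hs : s ≠ 0)
    (hrs : 1 / r + (n : ℝ≥0∞) / (2 * s) ≠ 1) : potentialExponent n r s ≠ 0 := by
  rw [potentialExponent_eq hr0 hr hs]
  refine mul_ne_zero (mul_ne_zero two_ne_zero (ENNReal.toReal_pos hr0 hr).ne')
    (sub_ne_zero.2 fun h => hrs ?_)
  rwa [ENNReal.toReal_eq_one_iff] at h

theorem potentialExponent_pos (hr0 : r ≠ 0) (hr : r ≠ ⊤) (hs : s ≠ 0)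
    (hrs : 1 < 1 / r + (n : ℝ≥0∞) / (2 * s)) : 0 < potentialExponent n r s := by
  have hfin : 1 / r + (n : ℝ≥0∞) / (2 * s) ≠ ⊤ :=
    ENNReal.add_ne_top.2 ⟨by simpa using hr0, ENNReal.div_ne_top (by simp) (by simp [hs])⟩
  rw [potentialExponent_eq hr0 hr hs]
  refine mul_pos (mul_pos two_pos (ENNReal.toReal_pos hr0 hr)) (sub_pos.2 ?_)
  simpa using (ENNReal.toReal_lt_toReal ENNReal.one_ne_top hfin).2 hrs

theorem memMixed_scaledPotential (I : Set ℝ) (hr0 : r ≠ 0) (hr : r ≠ ⊤) {w : Space n →ᵇ ℝ}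
    (hw : eLpNorm w s volume ≠ ⊤) {t N ε : ℕ → ℝ} (ht : Monotone t) (hN : ∀ j, 0 ≤ N j)
    (hε : ∀ j, 0 < ε j) (htN : ∀ j, t (j + 1) - t j = N j * ε j ^ 2) (c : ℕ → Space n)
    (hsum : Summable fun j => N j * ε j ^ potentialExponent n r s) :
    MemMixed I r s (piecewiseIco t fun j _ => scaledPotential w (ε j) (c j)) := by
  refine memMixed_piecewiseIco I hr0 hr ht
    (fun j => (scaledPotential w (ε j) (c j)).continuous.stronglyMeasurable) ?_
  have hterm (j : ℕ) : ENNReal.ofReal (t (j + 1) - t j) *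
      eLpNorm (scaledPotential w (ε j) (c j)) s volume ^ r.toReal
        = ENNReal.ofReal (N j * ε j ^ potentialExponent n r s) *
          eLpNorm w s volume ^ r.toReal := by
    rw [eLpNorm_scaledPotential w (hε j), htN, ENNReal.mul_rpow_of_nonneg _ _
      ENNReal.toReal_nonneg, ← mul_assoc, ENNReal.ofReal_rpow_of_nonneg
      (Real.rpow_nonneg (hε j).le _) ENNReal.toReal_nonneg, ← ENNReal.ofReal_mul
      (mul_nonneg (hN j) (sq_nonneg _)), ← Real.rpow_mul (hε j).le, potentialExponent,
      Real.rpow_add (hε j), Real.rpow_two, mul_comm (_ - _ : ℝ) r.toReal, mul_assoc]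
  simp only [hterm, ENNReal.tsum_mul_right]
  refine ENNReal.mul_ne_top ?_ (ENNReal.rpow_ne_top_of_nonneg ENNReal.toReal_nonneg hw)
  rw [← ENNReal.ofReal_tsum_of_nonneg
    (fun j => mul_nonneg (hN j) (Real.rpow_nonneg (hε j).le _)) hsum]
  exact ENNReal.ofReal_ne_top

/-- Admissibility makes the Strichartz ratio of a standing wave of duration `N ε²` invariant under
rescaling: all powers of `ε` cancel. -/
theorem eLpNorm_rescale_mul_rpow_div {F : Type*} [NormedAddCommGroup F] {p q : ℝ≥0∞}
    (hpq : Admissible n p q) {ε N : ℝ} (hε : 0 < ε) (hN : 0 ≤ N) (c : Space n) (f : Space n → F) :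
    eLpNorm (rescale ε c f) q volume * ENNReal.ofReal (N * ε ^ 2) ^ (1 / p).toReal /
        eLpNorm (rescale ε c f) 2 volume
      = ENNReal.ofReal N ^ (1 / p).toReal * (eLpNorm f q volume / eLpNorm f 2 volume) := by
  have hε0 : ENNReal.ofReal ε ≠ 0 := by simpa using hε
  have hhalf : (n : ℝ) * (1 / (2 : ℝ≥0∞)).toReal
      = 2 * (1 / p).toReal + n * (1 / q).toReal := by
    rw [hpq.two_mul_add_mul_eq]
    simp [div_eq_mul_inv]
  have hnum : eLpNorm (rescale ε c f) q volume * ENNReal.ofReal (N * ε ^ 2) ^ (1 / p).toReal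
      = ENNReal.ofReal ε ^ (2 * (1 / p).toReal + n * (1 / q).toReal) *
        (ENNReal.ofReal N ^ (1 / p).toReal * eLpNorm f q volume) := by
    rw [eLpNorm_rescale volume hε, finrank_euclideanSpace_fin, ENNReal.ofReal_mul hN,
      ENNReal.ofReal_pow hε.le, ENNReal.mul_rpow_of_nonneg _ _ ENNReal.toReal_nonneg,
      ← ENNReal.rpow_natCast, ← ENNReal.rpow_mul,
      ENNReal.rpow_add _ _ hε0 ENNReal.ofReal_ne_top]
    push_cast
    ring
  rw [hnum, eLpNorm_rescale volume hε, finrank_euclideanSpace_fin, hhalf,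
    ENNReal.mul_div_mul_left _ _ (by simp [ENNReal.rpow_eq_zero_iff, hε])
      (by simp [ENNReal.rpow_eq_top_iff, hε]), mul_div_assoc]

end Scaling

/-! ### Standing waves of a bound state -/

section StandingWave

variable {n : ℕ}

theorem eLpNorm_ne_zero_of_forall_ne_zero {X F : Type*} [TopologicalSpace X] [MeasurableSpace X]
    [BorelSpace X] [SecondCountableTopology X] [NormedAddCommGroup F] {μ : Measure X} [NeZero μ]
    {f : X → F} (hcont : Continuous f) (hf : ∀ x, f x ≠ 0) {q : ℝ≥0∞} (hq : q ≠ 0) :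
    eLpNorm f q μ ≠ 0 := by
  rw [Ne, eLpNorm_eq_zero_iff hcont.aestronglyMeasurable hq]
  intro hzero
  obtain ⟨x, hx⟩ := hzero.exists
  exact hf x hx

theorem standingWave_eq_free (f : L2 n) :
    standingWave f = fun t => free t (boundStateWave 1 f t) := by
  ext1 t
  rw [free_boundStateWave, standingWave, one_mul]

theorem isSolution_standingWave (I : Set ℝ) {w : Space n →ᵇ ℝ} {g : 𝓢(Space n, ℂ)}
    (hg : IsBoundState w 1 g) : IsSolution I (fun _ => w) (standingWave (g.toLp 2)) := by
  have hderiv := hg.hasDerivAt_boundStateWave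
  have hcont : Continuous (boundStateWave 1 (g.toLp 2)) :=
    continuous_iff_continuousAt.2 fun t => (hderiv t).continuousAt
  have hcont' : Continuous fun t => interaction w t (boundStateWave 1 (g.toLp 2) t) :=
    (isSkewFamily_interaction (Real.le_coe_toNNReal ‖w‖)).1.continuous_comp hcont
  rw [standingWave_eq_free]
  refine isSolution_of_interaction hcont (fun t => hcont'.intervalIntegrable _ _) (fun t => ?_)
    (Eventually.of_forall fun _ => rfl)
  rw [intervalIntegral.integral_eq_sub_of_hasDerivAt (fun τ _ => hderiv τ)
    (hcont'.intervalIntegrable _ _), add_sub_cancel]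

theorem memSobolev_toLp (g : 𝓢(Space n, ℂ)) (σ : ℝ) :
    TemperedDistribution.MemSobolev σ 2 ((g.toLp 2 : L2 n) : 𝓢'(Space n, ℂ)) := by
  rw [Lp.toTemperedDistribution_toLp_eq]
  exact g.memSobolev

theorem memMixed_top_const (I : Set ℝ) {s : ℝ≥0∞} {W : Space n → ℝ} (hW : MemLp W s volume) :
    MemMixed I ⊤ s fun _ => W :=
  ⟨hW.1.comp_snd, (memLp_top_const_enorm hW.2.ne).2⟩

theorem not_exists_strichartzNorm_le {I : Set ℝ} {V : ℝ → Space n → ℝ} {p q : ℝ≥0∞}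
    {u : ℝ → L2 n} (hu : IsSolution I V u) (htop : strichartzNorm I p q u = ⊤) :
    ¬ ∃ C : ℝ≥0, ∀ v : ℝ → L2 n, IsSolution I V v → strichartzNorm I p q v ≤ C * ‖v 0‖ₑ :=
  fun ⟨_, hC⟩ => ENNReal.mul_ne_top ENNReal.coe_ne_top enorm_ne_top
    (top_le_iff.1 (htop.symm.trans_le (hC u hu)))

end StandingWave

/-! ### Blow-up of the Strichartz ratios -/

section Blowup

variable {n : ℕ}

/-- Solutions `u k` of the equation with potential `V` on `I` along which no Strichartz estimate
other than the conservation of the `L²` norm holds uniformly. -/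
def IsStrichartzBlowup (I : Set ℝ) (V : ℝ → Space n → ℝ) (u : ℕ → ℝ → L2 n) : Prop :=
  (∀ k, IsSolution I V (u k) ∧ u k 0 ≠ 0) ∧
    ∀ p q : ℝ≥0∞, Admissible n p q → (p, q) ≠ (⊤, 2) →
      Tendsto (fun k => strichartzNorm I p q (u k) / ‖u k 0‖ₑ) atTop (𝓝 ⊤)

/-- The time at which the `k`-th copy of the potential, of scale `ε k`, is switched on, if the
`j`-th copy stays on for a time `(j + 1) ε_j²`. -/
def startTime (ε : ℕ → ℝ) (k : ℕ) : ℝ :=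
  ∑ j ∈ Finset.range k, ((j : ℝ) + 1) * ε j ^ 2

theorem startTime_succ_sub (ε : ℕ → ℝ) (k : ℕ) :
    startTime ε (k + 1) - startTime ε k = ((k : ℝ) + 1) * ε k ^ 2 := by
  rw [startTime, startTime, Finset.sum_range_succ_sub_sum]

theorem monotone_startTime (ε : ℕ → ℝ) : Monotone (startTime ε) :=
  monotone_nat_of_le_succ fun k => sub_nonneg.1 <| by
    rw [startTime_succ_sub]
    positivity

theorem startTime_nonneg (ε : ℕ → ℝ) (k : ℕ) : 0 ≤ startTime ε k :=
  Finset.sum_nonneg fun j _ => by positivity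

theorem startTime_le {ε : ℕ → ℝ} {T : ℝ} (hT : 0 ≤ T)
    (hε : ∀ j : ℕ, ((j : ℝ) + 1) * ε j ^ 2 ≤ T / 2 * (1 / 2) ^ j) (k : ℕ) :
    startTime ε k ≤ T :=
  calc startTime ε k
      ≤ ∑ j ∈ Finset.range k, T / 2 * (1 / 2) ^ j := Finset.sum_le_sum fun j _ => hε j
    _ = T / 2 * ∑ j ∈ Finset.range k, (1 / 2 : ℝ) ^ j := by rw [Finset.mul_sum]
    _ ≤ T / 2 * 2 := by
        gcongr
        exact sum_geometric_two_le k
    _ = T := by ring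

theorem tendsto_ofReal_succ_rpow_mul {x : ℝ} (hx : 0 < x) {C : ℝ≥0∞} (hC : C ≠ 0) :
    Tendsto (fun k : ℕ => ENNReal.ofReal (k + 1) ^ x * C) atTop (𝓝 ⊤) := by
  have hbase : Tendsto (fun k : ℕ => ENNReal.ofReal (k + 1)) atTop (𝓝 ⊤) :=
    ENNReal.tendsto_ofReal_atTop.comp
      (tendsto_atTop_add_const_right _ _ tendsto_natCast_atTop_atTop)
  have hpow := ENNReal.Tendsto.mul_const (b := C) (hbase.ennrpow_const x)
  rw [ENNReal.top_rpow_of_pos hx, ENNReal.top_mul hC] at hpow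
  exact hpow (Or.inl ENNReal.top_ne_zero)

theorem rpow_mul_div_le_strichartzNorm_div {p q : ℝ≥0∞} (hpq : Admissible n p q) (hp : p ≠ ⊤)
    {ε N a b : ℝ} (hε : 0 < ε) (hN : 0 ≤ N) (hab : b - a = N * ε ^ 2) {I : Set ℝ}
    (hI : Set.Ico a b ⊆ I) {c : Space n} {g : Space n → ℂ} {u : ℝ → L2 n}
    (hu : ∀ τ ∈ Set.Ico a b, eLpNorm (u τ) q volume = eLpNorm (rescale ε c g) q volume)
    (hu0 : ‖u 0‖ₑ = eLpNorm (rescale ε c g) 2 volume) :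
    ENNReal.ofReal N ^ (1 / p).toReal * (eLpNorm g q volume / eLpNorm g 2 volume)
      ≤ strichartzNorm I p q u / ‖u 0‖ₑ := by
  rw [hu0, ← eLpNorm_rescale_mul_rpow_div hpq hε hN c g, ← hab]
  exact ENNReal.div_le_div_right (mul_rpow_le_mixedNorm hpq.left_ne_zero hp hI hu) _

theorem isStrichartzBlowup_of_eLpNorm_eq (hn : 0 < n) {g : 𝓢(Space n, ℂ)} (hg : ∀ x, g x ≠ 0)
    {ε : ℕ → ℝ} (hε : ∀ k, 0 < ε k) {I : Set ℝ}
    (hI : ∀ k, Set.Ico (startTime ε k) (startTime ε (k + 1)) ⊆ I) {V : ℝ → Space n → ℝ}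
    {u : ℕ → ℝ → L2 n} (hsol : ∀ k, IsSolution I V (u k)) {c : ℕ → Space n}
    (hu : ∀ k q, ∀ τ ∈ Set.Ico (startTime ε k) (startTime ε (k + 1)),
      eLpNorm (u k τ) q volume = eLpNorm (rescale (ε k) (c k) g) q volume)
    (hu0 : ∀ k, ‖u k 0‖ₑ = eLpNorm (rescale (ε k) (c k) g) 2 volume) :
    IsStrichartzBlowup I V u := by
  have hg_norm {q : ℝ≥0∞} (hq : q ≠ 0) : eLpNorm g q volume ≠ 0 :=
    eLpNorm_ne_zero_of_forall_ne_zero g.continuous hg hq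
  refine ⟨fun k => ⟨hsol k, enorm_ne_zero.1 ?_⟩, fun p q hpq hne => ?_⟩
  · rw [hu0, eLpNorm_rescale volume (hε k)]
    exact mul_ne_zero (by simp [ENNReal.rpow_eq_zero_iff, hε k]) (hg_norm two_ne_zero)
  · have hp : p ≠ ⊤ := hpq.left_ne_top hn hne
    have hp_pos : 0 < (1 / p).toReal :=
      ENNReal.toReal_pos (by simpa using hp) (by simpa using hpq.left_ne_zero)
    have hratio : eLpNorm g q volume / eLpNorm g 2 volume ≠ 0 :=
      ENNReal.div_ne_zero.2 ⟨hg_norm hpq.right_ne_zero, (g.memLp 2 volume).2.ne⟩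
    exact tendsto_nhds_top_mono (tendsto_ofReal_succ_rpow_mul hp_pos hratio)
      (Eventually.of_forall fun k => rpow_mul_div_le_strichartzNorm_div hpq hp (hε k)
        (by positivity) (startTime_succ_sub ε k) (hI k) (hu k q) (hu0 k))

variable {r s : ℝ≥0∞}

theorem exists_memMixed_isStrichartzBlowup (hn : 0 < n) (hr0 : r ≠ 0) (hr : r ≠ ⊤) {ε : ℕ → ℝ}
    (hε : ∀ k, 0 < ε k)
    (hsum : Summable fun j : ℕ => ((j : ℝ) + 1) * ε j ^ potentialExponent n r s) :
    ∃ (V : ℝ → Space n → ℝ) (u : ℕ → ℝ → L2 n), ∀ I ⊆ Set.Ici 0,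
      (∀ k, Set.Ico (startTime ε k) (startTime ε (k + 1)) ⊆ I) →
        MemMixed I r s V ∧ IsStrichartzBlowup I V u := by
  obtain ⟨W, g, hW, hWs, hg0, hg⟩ := exists_boundState (Space n)
  obtain ⟨w, rfl⟩ : ∃ w : Space n →ᵇ ℝ, ⇑w = W := ⟨ofCompactSupport W hW.continuous hWs, rfl⟩
  have hw : Tendsto w (Bornology.cobounded (Space n)) (𝓝 0) := by
    rw [Metric.cobounded_eq_cocompact]
    exact hWs.is_zero_at_infty
  obtain ⟨c, u, hu⟩ := exists_isSolution_standingWave hn hw hg hε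
    (Finset.sum_range_zero _) (monotone_startTime ε)
  refine ⟨_, u, fun I hI0 hI => ⟨?_, isStrichartzBlowup_of_eLpNorm_eq hn hg0 hε hI
    (fun k => (hu k).1.mono hI0) (fun k => (hu k).2.1) fun k => (hu k).2.2⟩⟩
  exact memMixed_scaledPotential (N := fun j => (j : ℝ) + 1) I hr0 hr
    (hW.continuous.memLp_of_hasCompactSupport hWs).2.ne (monotone_startTime ε)
    (fun j => by positivity) hε (startTime_succ_sub ε) c hsum

theorem eventually_mul_rpow_le {e : ℝ} (he : 0 < e) (N : ℝ) {δ : ℝ} (hδ : 0 < δ) :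
    ∀ᶠ x : ℝ in 𝓝[>] 0, N * x ^ e ≤ δ := by
  have hlim : Tendsto (fun x : ℝ => N * x ^ e) (𝓝 0) (𝓝 (N * 0 ^ e)) :=
    (Real.continuousAt_rpow_const 0 e (Or.inr he.le)).tendsto.const_mul N
  rw [Real.zero_rpow he.ne', mul_zero] at hlim
  exact (hlim.mono_left nhdsWithin_le_nhds).eventually_le_const hδ

theorem exists_pos_mul_rpow_le {e : ℝ} (he : e ≠ 0) (N : ℝ) {δ : ℝ} (hδ : 0 < δ) :
    ∃ x : ℝ, 0 < x ∧ N * x ^ e ≤ δ := by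
  rcases he.lt_or_gt with he | he
  · obtain ⟨x, hle, hx : 0 < x⟩ := ((eventually_mul_rpow_le (neg_pos.2 he) N hδ).and
      self_mem_nhdsWithin).exists
    refine ⟨x⁻¹, inv_pos.2 hx, ?_⟩
    rwa [Real.inv_rpow hx.le, ← Real.rpow_neg hx.le]
  · exact ((eventually_mul_rpow_le he N hδ).and self_mem_nhdsWithin).exists.imp
      fun _ h => h.symm

theorem exists_global_isStrichartzBlowup (hn : 0 < n) (hr0 : r ≠ 0) (hr : r ≠ ⊤) (hs : s ≠ 0)
    (hrs : 1 / r + (n : ℝ≥0∞) / (2 * s) ≠ 1) :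
    ∃ (V : ℝ → Space n → ℝ) (u : ℕ → ℝ → L2 n),
      MemMixed (Set.Ici 0) r s V ∧ IsStrichartzBlowup (Set.Ici 0) V u := by
  choose ε hε hle using fun j : ℕ => exists_pos_mul_rpow_le
    (potentialExponent_ne_zero hr0 hr hs hrs) ((j : ℝ) + 1) (δ := (1 / 2) ^ j) (by positivity)
  have hsum : Summable fun j : ℕ => ((j : ℝ) + 1) * ε j ^ potentialExponent n r s :=
    summable_geometric_two.of_nonneg_of_le
      (fun j => mul_nonneg (by positivity) (Real.rpow_nonneg (hε j).le _)) hle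
  obtain ⟨V, u, hVu⟩ := exists_memMixed_isStrichartzBlowup hn hr0 hr hε hsum
  exact ⟨V, u, hVu _ subset_rfl fun k τ hτ => (startTime_nonneg ε k).trans hτ.1⟩

theorem exists_local_isStrichartzBlowup (hn : 0 < n) (hr0 : r ≠ 0) (hr : r ≠ ⊤) (hs : s ≠ 0)
    (hrs : 1 < 1 / r + (n : ℝ≥0∞) / (2 * s)) {T : ℝ} (hT : 0 < T) :
    ∃ (V : ℝ → Space n → ℝ) (u : ℕ → ℝ → L2 n),
      MemMixed (Set.Icc 0 T) r s V ∧ IsStrichartzBlowup (Set.Icc 0 T) V u := by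
  have hexists (j : ℕ) : ∃ x : ℝ, 0 < x ∧
      ((j : ℝ) + 1) * x ^ potentialExponent n r s ≤ (1 / 2) ^ j ∧
      ((j : ℝ) + 1) * x ^ (2 : ℝ) ≤ T / 2 * (1 / 2) ^ j :=
    (eventually_mem_nhdsWithin.and
      ((eventually_mul_rpow_le (potentialExponent_pos hr0 hr hs hrs) _ (by positivity)).and
        (eventually_mul_rpow_le two_pos _ (by positivity)))).exists
  choose ε hε hle hduration using hexists
  have hsum : Summable fun j : ℕ => ((j : ℝ) + 1) * ε j ^ potentialExponent n r s :=
    summable_geometric_two.of_nonneg_of_le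
      (fun j => mul_nonneg (by positivity) (Real.rpow_nonneg (hε j).le _)) hle
  have hstart : ∀ k, startTime ε k ≤ T :=
    startTime_le hT.le fun j => by simpa only [Real.rpow_two] using hduration j
  obtain ⟨V, u, hVu⟩ := exists_memMixed_isStrichartzBlowup hn hr0 hr hε hsum
  exact ⟨V, u, hVu _ Set.Icc_subset_Ici_self fun k τ hτ =>
    ⟨(startTime_nonneg ε k).trans hτ.1, hτ.2.le.trans (hstart _)⟩⟩

end Blowup

end Schrodinger

end

open Schrodinger in
theorem theorem1p3_general (n : ℕ) (hn : 0 < n) :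
    (∃ (W : Space n → ℝ) (u₀ : Space n → ℂ) (h₂ : MemLp u₀ 2 volume),
      ContDiff ℝ ∞ W ∧ HasCompactSupport W ∧
      ContDiff ℝ ∞ u₀ ∧
      (∀ σ : ℝ, 0 < σ →
        TemperedDistribution.MemSobolev σ 2 ((h₂.toLp u₀ : L2 n) : 𝓢'(Space n, ℂ))) ∧
      (∀ x, -(Δ u₀) x + (W x : ℂ) * u₀ x + u₀ x = 0) ∧
      (∀ s : ℝ≥0∞, 1 ≤ s → MemMixed (Set.Ici 0) ⊤ s (fun _ => W)) ∧
      IsSolution (Set.Ici 0) (fun _ => W) (standingWave (h₂.toLp u₀)) ∧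
      ∀ p q : ℝ≥0∞, Admissible n p q → (p, q) ≠ (⊤, 2) →
        strichartzNorm (Set.Ici 0) p q (standingWave (h₂.toLp u₀)) = ⊤ ∧
        ¬ ∃ C : ℝ≥0, ∀ v : ℝ → L2 n, IsSolution (Set.Ici 0) (fun _ => W) v →
          strichartzNorm (Set.Ici 0) p q v ≤ C * ‖v 0‖ₑ) ∧
    (∀ r s : ℝ≥0∞, 0 < r → r < ⊤ → 0 < s → 1 / r + (n : ℝ≥0∞) / (2 * s) ≠ 1 →
      ∃ (V : ℝ → Space n → ℝ) (u : ℕ → ℝ → L2 n),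
        MemMixed (Set.Ici 0) r s V ∧ IsStrichartzBlowup (Set.Ici 0) V u) ∧
    (∀ r s : ℝ≥0∞, 0 < r → r < ⊤ → 0 < s → 1 < 1 / r + (n : ℝ≥0∞) / (2 * s) →
      ∀ T : ℝ, 0 < T → ∃ (V : ℝ → Space n → ℝ) (u : ℕ → ℝ → L2 n),
        MemMixed (Set.Icc 0 T) r s V ∧ IsStrichartzBlowup (Set.Icc 0 T) V u) := by
  refine ⟨?_, fun r s hr0 hr hs hrs =>
      exists_global_isStrichartzBlowup hn hr0.ne' hr.ne hs.ne' hrs,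
    fun r s hr0 hr hs hrs T hT =>
      exists_local_isStrichartzBlowup hn hr0.ne' hr.ne hs.ne' hrs hT⟩
  obtain ⟨W, g, hW, hWs, hg0, hg⟩ := exists_boundState (Space n)
  have hsol : IsSolution (Set.Ici 0) (fun _ => W) (standingWave (g.toLp 2)) :=
    isSolution_standingWave _ (w := ofCompactSupport W hW.continuous hWs) hg
  refine ⟨W, g, g.memLp 2 volume, hW, hWs, g.smooth ⊤, fun σ _ => memSobolev_toLp g σ,
    fun x => by simpa using hg x,
    fun s _ => memMixed_top_const _ (hW.continuous.memLp_of_hasCompactSupport hWs), hsol,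
    fun p q hpq hne => ?_⟩
  have hnorm : eLpNorm (g.toLp 2 volume) q volume ≠ 0 := by
    rw [eLpNorm_congr_ae (g.coeFn_toLp 2 volume)]
    exact eLpNorm_ne_zero_of_forall_ne_zero g.continuous hg0 hpq.right_ne_zero
  have htop : strichartzNorm (Set.Ici 0) p q (standingWave (g.toLp 2)) = ⊤ :=
    strichartzNorm_standingWave hpq.left_ne_zero (hpq.left_ne_top hn hne) hnorm
  exact ⟨htop, not_exists_strichartzNorm_le hsol htop⟩

theorem theorem1p3 (n : ℕ) (hn : 2 ≤ n) :
    -- (i) a standing wave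
    (∃ (W : Schrodinger.Space n → ℝ) (u₀ : Schrodinger.Space n → ℂ) (h₂ : MemLp u₀ 2 volume),
      ContDiff ℝ ∞ W ∧ HasCompactSupport W ∧
      ContDiff ℝ ∞ u₀ ∧
      (∀ σ : ℝ, 0 < σ → TemperedDistribution.MemSobolev σ 2
        ((h₂.toLp u₀ : Schrodinger.L2 n) : 𝓢'(Schrodinger.Space n, ℂ))) ∧
      (∀ x, -(Δ u₀) x + (W x : ℂ) * u₀ x + u₀ x = 0) ∧
      (∀ s : ℝ≥0∞, 1 ≤ s → Schrodinger.MemMixed (Set.Ici 0) ⊤ s (fun _ => W)) ∧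
      Schrodinger.IsSolution (Set.Ici 0) (fun _ => W)
        (Schrodinger.standingWave (h₂.toLp u₀)) ∧
      ∀ p q : ℝ≥0∞, Schrodinger.Admissible n p q → (p, q) ≠ (⊤, 2) →
        Schrodinger.strichartzNorm (Set.Ici 0) p q
          (Schrodinger.standingWave (h₂.toLp u₀)) = ⊤ ∧
        ¬ ∃ C : ℝ≥0, ∀ v : ℝ → Schrodinger.L2 n,
          Schrodinger.IsSolution (Set.Ici 0) (fun _ => W) v →
          Schrodinger.strichartzNorm (Set.Ici 0) p q v ≤ C * ‖v 0‖ₑ) ∧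
    -- (ii) failure of the global estimates
    (∀ r s : ℝ≥0∞, 1 ≤ r → r < ⊤ → (n : ℝ≥0∞) / 2 < s →
      1 / r + (n : ℝ≥0∞) / (2 * s) ≠ 1 →
      ∃ (V : ℝ → Schrodinger.Space n → ℝ) (u : ℕ → ℝ → Schrodinger.L2 n),
        Schrodinger.MemMixed (Set.Ici 0) r s V ∧
        (∀ k, Schrodinger.IsSolution (Set.Ici 0) V (u k) ∧ u k 0 ≠ 0) ∧
        ∀ p q : ℝ≥0∞, Schrodinger.Admissible n p q → (p, q) ≠ (⊤, 2) →
          Tendsto (fun k => Schrodinger.strichartzNorm (Set.Ici 0) p q (u k) / ‖u k 0‖ₑ)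
            atTop (𝓝 ⊤)) ∧
    -- (iii) failure of the local estimates
    (∀ r s : ℝ≥0∞, 1 ≤ r → r < ⊤ → (n : ℝ≥0∞) / 2 < s →
      1 < 1 / r + (n : ℝ≥0∞) / (2 * s) →
      ∀ T : ℝ, 0 < T →
      ∃ (V : ℝ → Schrodinger.Space n → ℝ) (u : ℕ → ℝ → Schrodinger.L2 n),
        Schrodinger.MemMixed (Set.Icc 0 T) r s V ∧
        (∀ k, Schrodinger.IsSolution (Set.Icc 0 T) V (u k) ∧ u k 0 ≠ 0) ∧
        ∀ p q : ℝ≥0∞, Schrodinger.Admissible n p q → (p, q) ≠ (⊤, 2) →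
          Tendsto (fun k => Schrodinger.strichartzNorm (Set.Icc 0 T) p q (u k) / ‖u k 0‖ₑ)
            atTop (𝓝 ⊤)) := by
  obtain ⟨hstanding, hglobal, hlocal⟩ := theorem1p3_general n (two_pos.trans_le hn)
  exact ⟨hstanding,
    fun r s hr1 hr hs => hglobal r s (one_pos.trans_le hr1) hr (bot_le.trans_lt hs),
    fun r s hr1 hr hs => hlocal r s (one_pos.trans_le hr1) hr (bot_le.trans_lt hs)⟩
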